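/- Let $\mathbb{K}$ be a field, $R$ a commutative noetherian $\mathbb{K}$-algebra, and $\Gamma$ a module-finite (not necessarily commutative) $R$-algebra. By a $\Gamma$-bimodule we mean a $\Gamma\otimes_R\Gamma^{\mathrm{op}}$-module, i.e. a bimodule on which $R$ acts centrally; for a maximal ideal $\mathfrak m$ of $R$, the localization $M_{\mathfrak m}=M\otimes_R R_{\mathfrak m}$ of a $\Gamma$-bimodule (or of a complex of such) is then a (complex of) $\Gamma_{\mathfrak m}$-bimodule(s), where $\Gamma_{\mathfrak m}=\Gamma\otimes_R R_{\mathfrak m}$. For a ring $A$, a complex $M$ of $A$-bimodules is called biperfect if it is perfect both as a complex of right $A$-modules and as a complex of left $A$-modules, where a complex is perfect if it is quasi-isomorphic to a bounded complex of finitely generated projective modules. It is called tilting if it is biperfect, the left multiplication map $A\to \mathbf{R}\mathrm{Hom}_{A}(M,M)$ (derived endomorphisms of $M$ as a complex of right modules) is an isomorphism in the derived category, and the right multiplication map $A\to \mathbf{R}\mathrm{Hom}_{A^{\mathrm{op}}}(M,M)$ (derived endomorphisms of $M$ as a complex of left modules) is an isomorphism in the derived category. A bimodule is called tilting if it is tilting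 as a complex concentrated in degree $0$. (1) Let $M$ be a biperfect complex of finitely generated $\Gamma$-bimodules. If $M_{\mathfrak m}$ is a tilting complex of $\Gamma_{\mathfrak m}$-bimodules for every maximal ideal $\mathfrak m$ of $R$, then $M$ is tilting. (2) Let $M$ be a finitely generated $\Gamma$-bimodule. If there is an integer $n\ge 0$ such that for every maximal ideal $\mathfrak m$ of $R$ one has $\mathrm{pd}_{\Gamma_{\mathfrak m}}(M_{\mathfrak m})\le n$, $\mathrm{pd}_{\Gamma_{\mathfrak m}^{\mathrm{op}}}(M_{\mathfrak m})\le n$, and $M_{\mathfrak m}$ is tilting, then $M$ is tilting. -/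

import Mathlib

open CategoryTheory TensorProduct MulOpposite

universe u

noncomputable section

namespace TiltingBimod

/-! ### Bimodules and one-sided restriction -/

/-- The enveloping algebra `A ⊗[k] Aᵐᵒᵖ`. A module over it is an `A`-bimodule on which
the two actions of `k` agree. -/
abbrev Env (k A : Type u) [CommRing k] [Ring A] [Algebra k A] : Type u := A ⊗[k] Aᵐᵒᵖ

section Restriction

variable (k A : Type u) [CommRing k] [Ring A] [Algebra k A]

/-- `a ↦ a ⊗ 1`, through which a bimodule is a left `A`-module. -/
abbrev inl : A →+* Env k A :=
  (Algebra.TensorProduct.includeLeft : A →ₐ[k] A ⊗[k] Aᵐᵒᵖ).toRingHom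

/-- `b ↦ 1 ⊗ b`, through which a bimodule is a right `A`-module, i.e. an `Aᵐᵒᵖ`-module. -/
abbrev inr : Aᵐᵒᵖ →+* Env k A :=
  (Algebra.TensorProduct.includeRight : Aᵐᵒᵖ →ₐ[k] A ⊗[k] Aᵐᵒᵖ).toRingHom

lemma commute_inl_inr (a : A) (b : Aᵐᵒᵖ) : Commute (inl k A a) (inr k A b) := by
  simp [Commute, SemiconjBy]

/-- The underlying left module of a bimodule. -/
abbrev leftRes : ModuleCat.{u} (Env k A) ⥤ ModuleCat.{u} A :=
  ModuleCat.restrictScalars (inl k A)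

/-- The underlying right module of a bimodule. -/
abbrev rightRes : ModuleCat.{u} (Env k A) ⥤ ModuleCat.{u} Aᵐᵒᵖ :=
  ModuleCat.restrictScalars (inr k A)

end Restriction

/-! ### Perfect complexes -/

/-- A complex of `S`-modules is perfect if it is quasi-isomorphic to a bounded complex of
finitely generated projective modules. (Such a complex `P` is K-projective, so that an
isomorphism in the derived category is represented by a quasi-isomorphism out of `P`.) -/
def IsPerfect {S : Type u} [Ring S] (X : CochainComplex (ModuleCat.{u} S) ℤ) : Prop :=
  ∃ (P : CochainComplex (ModuleCat.{u} S) ℤ) (p : P ⟶ X),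
    (∃ a b : ℤ, ∀ i, i < a ∨ b < i → Limits.IsZero (P.X i)) ∧
    (∀ i, Module.Finite S (P.X i) ∧ Module.Projective S (P.X i)) ∧
    QuasiIso p

/-! ### Multiplication maps into the derived endomorphism complex -/

section Multiplication

variable {E S T : Type u} [Ring E] [Ring S] [Ring T]
  (f : S →+* E) (g : T →+* E) (h : ∀ s t, Commute (f s) (g t))

/-- The action of `t : T` on the `E`-module `X`, as an `S`-linear endomorphism. -/
def actHom (t : T) (X : ModuleCat.{u} E) :
    (ModuleCat.restrictScalars f).obj X ⟶ (ModuleCat.restrictScalars f).obj X :=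
  ModuleCat.ofHom (X := (ModuleCat.restrictScalars f).obj X)
    (Y := (ModuleCat.restrictScalars f).obj X)
    { toFun := fun x => (g t • (show X from x) : X)
      map_add' := fun x y => smul_add (g t) (show X from x) (show X from y)
      map_smul' := fun s x => by
        change g t • (f s • (show X from x)) = f s • (g t • (show X from x))
        rw [smul_smul, smul_smul, (h s t).eq] }

/-- The action of `t : T` on a complex of `E`-modules, as an endomorphism of the underlying
complex of `S`-modules. -/
def actComplex (t : T) (M : CochainComplex (ModuleCat.{u} E) ℤ) :
    ((ModuleCat.restrictScalars f).mapHomologicalComplex _).obj M ⟶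
      ((ModuleCat.restrictScalars f).mapHomologicalComplex _).obj M where
  f i := actHom f g h t (M.X i)
  comm' i j _ := by
    ext x
    exact (M.d i j).hom.map_smul (g t) x

/-- For a morphism `p : P ⟶ M` of complexes of `S`-modules, the morphism of complexes
`T → Hom*_S(P, M)`, `t ↦ (x ↦ t • p x)`, with `T` in degree zero. When `p` is a K-projective
resolution, the target computes `RHom_S(M, M)` and this is the multiplication map
`T → RHom_S(M, M)`. -/
def mulMap (M : CochainComplex (ModuleCat.{u} E) ℤ) (P : CochainComplex (ModuleCat.{u} S) ℤ)
    (p : P ⟶ ((ModuleCat.restrictScalars f).mapHomologicalComplex _).obj M) :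
    (HomologicalComplex.single AddCommGrpCat.{u} (ComplexShape.up ℤ) 0).obj
        (AddCommGrpCat.of T) ⟶
      CochainComplex.HomComplex P
        (((ModuleCat.restrictScalars f).mapHomologicalComplex _).obj M) :=
  HomologicalComplex.mkHomFromSingle
    (AddCommGrpCat.ofHom
      { toFun := fun t => CochainComplex.HomComplex.Cochain.ofHom (p ≫ actComplex f g h t M)
        map_zero' := by
          rw [← CochainComplex.HomComplex.Cochain.ofHom_zero]
          congr 1
          ext i x
          change g 0 • (show M.X i from p.f i x) = 0
          rw [map_zero, zero_smul]
        map_add' := fun t t' => by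
          rw [← CochainComplex.HomComplex.Cochain.ofHom_add]
          congr 1
          ext i x
          change g (t + t') • (show M.X i from p.f i x) =
            g t • (show M.X i from p.f i x) + g t' • (show M.X i from p.f i x)
          rw [map_add, add_smul] })
    (fun j _ => by
      ext t
      exact CochainComplex.HomComplex.δ_ofHom (p := j) (p ≫ actComplex f g h t M))

/-- The multiplication map `T → RHom_S(M, M)` is an isomorphism in the derived category, where
`RHom_S(M, M)` is computed by a K-projective resolution `P` of `M` over `S`. (Whether it is a
quasi-isomorphism depends neither on `P` nor on the bimodule structures it respects.) -/
def MulIsIso (M : CochainComplex (ModuleCat.{u} E) ℤ) : Prop :=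
  ∃ (P : CochainComplex (ModuleCat.{u} S) ℤ)
    (p : P ⟶ ((ModuleCat.restrictScalars f).mapHomologicalComplex _).obj M),
    P.IsKProjective ∧ QuasiIso p ∧ QuasiIso (mulMap f g h M P p)

end Multiplication

/-! ### Tilting complexes of bimodules -/

section Tilting

variable (k A : Type u) [CommRing k] [Ring A] [Algebra k A]

/-- Perfect as a complex of left modules and as a complex of right modules. -/
def IsBiperfect (M : CochainComplex (ModuleCat.{u} (Env k A)) ℤ) : Prop :=
  IsPerfect (((leftRes k A).mapHomologicalComplex _).obj M) ∧
  IsPerfect (((rightRes k A).mapHomologicalComplex _).obj M)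

/-- A (two-sided) tilting complex of `A`-bimodules: it is biperfect, the left multiplication
`A → RHom_A(M, M)` into the derived endomorphisms of `M` as a right module is an isomorphism,
and so is the right multiplication `A → RHom_{Aᵒᵖ}(M, M)` into the derived endomorphisms of
`M` as a left module. -/
structure IsTilting (M : CochainComplex (ModuleCat.{u} (Env k A)) ℤ) : Prop where
  biperfect : IsBiperfect k A M
  left_mul : MulIsIso (inr k A) (inl k A) (fun b a => (commute_inl_inr k A a b).symm) M
  right_mul : MulIsIso (inl k A) (inr k A) (fun a b => commute_inl_inr k A a b) M

end Tilting

/-! ### Localization -/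

section Localization

variable {R : Type u} [CommRing R] (m : Ideal R) [m.IsPrime]
  (Γ : Type u) [Ring Γ] [Algebra R Γ]

/-- `Γ_m`, an algebra over `R_m`. -/
abbrev LocAlg : Type u := Localization.AtPrime m ⊗[R] Γ

/-- The underlying `R`-module of a bimodule. -/
@[reducible] def bimodBase (M : ModuleCat.{u} (Env R Γ)) : Module R M :=
  Module.restrictScalars R (Env R Γ) M

attribute [local instance] bimodBase

lemma bimodBase_tower (M : ModuleCat.{u} (Env R Γ)) : IsScalarTower R (Env R Γ) M :=
  IsScalarTower.restrictScalars R (Env R Γ) M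

attribute [local instance] bimodBase_tower

/-- `M_m = R_m ⊗[R] M` -/
abbrev LocMod (M : ModuleCat.{u} (Env R Γ)) : Type u := Localization.AtPrime m ⊗[R] M

/-- `Γ ⊗ Γᵐᵒᵖ` acts on `R_m ⊗ M` through the second factor. -/
def envAct (M : ModuleCat.{u} (Env R Γ)) :
    Env R Γ →ₐ[R] Module.End (Localization.AtPrime m) (LocMod m Γ M) :=
  (Module.End.baseChangeHom R (Localization.AtPrime m) M).comp (Algebra.lsmul R R M)

lemma envAct_tmul (M : ModuleCat.{u} (Env R Γ)) (e : Env R Γ) (t : Localization.AtPrime m)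
    (x : M) : envAct m Γ M e (t ⊗ₜ x) = t ⊗ₜ (e • x) :=
  rfl

/-- The left action of `Γ_m` on `M_m`. -/
def locLeft (M : ModuleCat.{u} (Env R Γ)) :
    LocAlg m Γ →ₐ[Localization.AtPrime m]
      Module.End (Localization.AtPrime m) (LocMod m Γ M) :=
  Algebra.TensorProduct.lift (Algebra.ofId _ _)
    ((envAct m Γ M).comp Algebra.TensorProduct.includeLeft)
    (fun r _ => Algebra.commutes r _)

/-- The right action of `Γ_m` on `M_m`. -/
def locRight (M : ModuleCat.{u} (Env R Γ)) :
    (LocAlg m Γ)ᵐᵒᵖ →ₐ[Localization.AtPrime m]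
      Module.End (Localization.AtPrime m) (LocMod m Γ M) :=
  AlgHom.opComm (Algebra.TensorProduct.lift (Algebra.ofId _ _)
    (AlgHom.opComm.symm ((envAct m Γ M).comp Algebra.TensorProduct.includeRight))
    (fun r _ => Algebra.commutes r _))

lemma locLeft_tmul (M : ModuleCat.{u} (Env R Γ)) (r t : Localization.AtPrime m) (a : Γ) (x : M) :
    locLeft m Γ M (r ⊗ₜ a) (t ⊗ₜ x) = (r * t) ⊗ₜ (inl R Γ a • x) := by
  change r • envAct m Γ M (inl R Γ a) (t ⊗ₜ x) = _
  rw [envAct_tmul, smul_tmul', smul_eq_mul]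

lemma locRight_tmul (M : ModuleCat.{u} (Env R Γ)) (r t : Localization.AtPrime m) (b : Γ) (x : M) :
    locRight m Γ M (op (r ⊗ₜ b)) (t ⊗ₜ x) = (r * t) ⊗ₜ (inr R Γ (op b) • x) := by
  change envAct m Γ M (inr R Γ (op b)) (r • (t ⊗ₜ x)) = _
  rw [smul_tmul', smul_eq_mul, envAct_tmul]

lemma locLeft_locRight (M : ModuleCat.{u} (Env R Γ)) (a : LocAlg m Γ) (b : (LocAlg m Γ)ᵐᵒᵖ) :
    Commute (locLeft m Γ M a) (locRight m Γ M b) := by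
  induction b using MulOpposite.rec' with | _ b
  induction a using TensorProduct.induction_on with
  | zero => simp
  | add x y hx hy => simpa using hx.add_left hy
  | tmul r a =>
    induction b using TensorProduct.induction_on with
    | zero => simp
    | add x y hx hy => simpa using hx.add_right hy
    | tmul s b =>
      ext x
      simp only [Module.End.mul_apply, AlgebraTensorModule.curry_apply, curry_apply,
        LinearMap.coe_restrictScalars, locLeft_tmul,
        locRight_tmul, smul_smul, (commute_inl_inr R Γ a (op b)).eq]
      rw [mul_left_comm]

/-- The action of `Γ_m ⊗ Γ_mᵐᵒᵖ` on `M_m`, combining the two one-sided actions. -/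
def locAct (M : ModuleCat.{u} (Env R Γ)) :
    Env (Localization.AtPrime m) (LocAlg m Γ) →ₐ[Localization.AtPrime m]
      Module.End (Localization.AtPrime m) (LocMod m Γ M) :=
  Algebra.TensorProduct.lift (locLeft m Γ M) (locRight m Γ M) (locLeft_locRight m Γ M)

/-- `M_m` as a module over `Γ_m ⊗ Γ_mᵐᵒᵖ`, i.e. as a `Γ_m`-bimodule. -/
@[reducible] def locModule (M : ModuleCat.{u} (Env R Γ)) :
    Module (Env (Localization.AtPrime m) (LocAlg m Γ)) (LocMod m Γ M) :=
  Module.compHom (LocMod m Γ M) (locAct m Γ M).toRingHom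

/-- The localization `M_m` of a `Γ`-bimodule `M`, as a `Γ_m`-bimodule. -/
def locObj (M : ModuleCat.{u} (Env R Γ)) :
    ModuleCat.{u} (Env (Localization.AtPrime m) (LocAlg m Γ)) :=
  letI := locModule m Γ M
  ModuleCat.of _ (LocMod m Γ M)

/-- The localized action is `((r ⊗ a) ⊗ (s ⊗ b)) • (t ⊗ x) = r s t ⊗ a x b`. -/
lemma locAct_tmul (M : ModuleCat.{u} (Env R Γ)) (r s t : Localization.AtPrime m) (a b : Γ)
    (x : M) :
    locAct m Γ M ((r ⊗ₜ a) ⊗ₜ op (s ⊗ₜ b)) (t ⊗ₜ x) =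
      (r * (s * t)) ⊗ₜ (inl R Γ a • inr R Γ (op b) • x) := by
  simp only [locAct, Algebra.TensorProduct.lift_tmul, Module.End.mul_apply, locRight_tmul,
    locLeft_tmul]

/-- The localization `R_m ⊗ φ` of a homomorphism of bimodules, as an `R_m`-linear map. -/
def locLin {M N : ModuleCat.{u} (Env R Γ)} (φ : M ⟶ N) :
    LocMod m Γ M →ₗ[Localization.AtPrime m] LocMod m Γ N :=
  (φ.hom.restrictScalars R).baseChange (Localization.AtPrime m)

lemma locLin_locAct {M N : ModuleCat.{u} (Env R Γ)} (φ : M ⟶ N)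
    (e : Env (Localization.AtPrime m) (LocAlg m Γ)) (y : LocMod m Γ M) :
    locLin m Γ φ (locAct m Γ M e y) = locAct m Γ N e (locLin m Γ φ y) := by
  induction e using TensorProduct.induction_on with
  | zero => simp
  | add e e' he he' => simp only [map_add, LinearMap.add_apply, he, he']
  | tmul a b =>
    induction b using MulOpposite.rec' with | _ b
    induction a using TensorProduct.induction_on with
    | zero => simp
    | add e e' he he' => simp only [add_tmul, map_add, LinearMap.add_apply, he, he']
    | tmul r a =>
      induction b using TensorProduct.induction_on with
      | zero => simp
      | add e e' he he' =>
        rw [MulOpposite.op_add, tmul_add, map_add, map_add, LinearMap.add_apply, LinearMap.add_apply, map_add,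
          he, he']
      | tmul s b =>
        induction y using TensorProduct.induction_on with
        | zero => simp
        | add y y' hy hy' => simp only [map_add, hy, hy']
        | tmul t x =>
          rw [locAct_tmul]
          simp only [locLin, LinearMap.baseChange_tmul, LinearMap.coe_restrictScalars, map_smul]
          rw [locAct_tmul]

/-- Localization at `m`, as a functor from `Γ`-bimodules to `Γ_m`-bimodules. -/
def locFunctor :
    ModuleCat.{u} (Env R Γ) ⥤
      ModuleCat.{u} (Env (Localization.AtPrime m) (LocAlg m Γ)) where
  obj M := locObj m Γ M
  map {M N} φ :=
    ModuleCat.ofHom (X := locObj m Γ M) (Y := locObj m Γ N)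
      { toFun := locLin m Γ φ
        map_add' := fun y y' => (locLin m Γ φ).map_add y y'
        map_smul' := fun e y => locLin_locAct m Γ φ e y }
  map_id M := by
    ext y
    change locLin m Γ (𝟙 M) y = y
    exact LinearMap.congr_fun (LinearMap.baseChange_id (R := R)) y
  map_comp φ ψ := by
    ext y
    change locLin m Γ (φ ≫ ψ) y = locLin m Γ ψ (locLin m Γ φ y)
    exact LinearMap.congr_fun (LinearMap.baseChange_comp (A := Localization.AtPrime m)
      (φ.hom.restrictScalars R) (ψ.hom.restrictScalars R)) y

instance : (locFunctor m Γ).Additive where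
  map_add {M N φ ψ} := by
    ext y
    change locLin m Γ (φ + ψ) y = locLin m Γ φ y + locLin m Γ ψ y
    exact LinearMap.congr_fun (LinearMap.baseChange_add (A := Localization.AtPrime m)
      (φ.hom.restrictScalars R) (ψ.hom.restrictScalars R)) y

/-- The localization of a complex of `Γ`-bimodules. -/
def locComplex (M : CochainComplex (ModuleCat.{u} (Env R Γ)) ℤ) :
    CochainComplex (ModuleCat.{u} (Env (Localization.AtPrime m) (LocAlg m Γ))) ℤ :=
  ((locFunctor m Γ).mapHomologicalComplex _).obj M

end Localization

/-- A module regarded as a complex concentrated in degree zero. -/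
abbrev inDegreeZero {S : Type u} [Ring S] (X : ModuleCat.{u} S) :
    CochainComplex (ModuleCat.{u} S) ℤ :=
  (HomologicalComplex.single (ModuleCat.{u} S) (ComplexShape.up ℤ) 0).obj X

end TiltingBimod

end

noncomputable section

namespace TiltingBimod

open CochainComplex CochainComplex.HomComplex

/-! Let `S` be `Γ` or `Γᵐᵒᵖ`, and let `P` be a bounded resolution of `M` over `S` by finitely
generated projectives. The multiplication map into `Hom*_S(P, M)` is a quasi-isomorphism exactly
when the cohomology vanishes in nonzero degrees, every morphism `P ⟶ M` is homotopic to a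
multiplication, and only `0` acts null-homotopically (`RepresentsHom`). Each condition says that an
element of an `R`-module lies in a submodule, which can be tested at the maximal ideals
(`mem_of_forall_maximal`). As `R` is noetherian and `Γ` is finite over it, the terms of `P` are
finitely presented over `R`; as `P` is bounded, `Hom*_S(P, -)` then commutes with localization.
Concretely, one clears denominators in cochains (`cochain_exists_lift`,
`cochain_exists_smul_eq_zero`), which gives `RepresentsHom.of_localization`.

To use the local hypothesis, note that `P_m` is a bounded complex of projectives over `S_m` and, by
flatness, resolves `M_m`. It may replace the resolution supplied by the hypothesis
(`RepresentsHom.of_quasiIso`), and the adjunction identifies `Hom*_{S_m}(P_m, M_m)` with `Hom*_S(P,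
M_m)` (`RepresentsHom.transpose`). Doing this on both sides proves (1).

For (2) it remains to see that `M` is biperfect, by induction on `n`
(`isPerfect_of_forall_maximal`). If `n = 0`, the splitting of a finite free cover is again a
membership statement, hence local. Otherwise the kernel of a finite free cover has local projective
dimension at most `n - 1`, so it is perfect, and `M` is quasi-isomorphic to the cone of its
inclusion. -/

/-- The family `β : T → Hom(P, N)` of morphisms of complexes identifies `T` with the cohomology
of the complex `Hom*(P, N)`, placed in degree zero. -/
structure RepresentsHom {C : Type*} [Category* C] [Preadditive C] {P N : CochainComplex C ℤ}
    {T : Type*} [Zero T] (β : T → (P ⟶ N)) : Prop where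
  exact : ∀ n : ℤ, n ≠ 0 → ∀ z : Cochain P N n, δ n (n + 1) z = 0 →
    ∃ w : Cochain P N (n - 1), δ (n - 1) n w = z
  surj : ∀ u : P ⟶ N, ∃ t, ∃ w : Cochain P N (-1),
    Cochain.ofHom u = Cochain.ofHom (β t) + δ (-1) 0 w
  inj : ∀ t, (∃ w : Cochain P N (-1), Cochain.ofHom (β t) = δ (-1) 0 w) → t = 0

/-! ### Quasi-isomorphisms into a Hom complex, in terms of cochains -/

section HomComplexHomology

variable {C : Type*} [Category.{u} C] [Preadditive C] {P N : CochainComplex C ℤ}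

lemma exactAt_homComplex_iff (n : ℤ) :
    (HomComplex P N).ExactAt n ↔ ∀ z : Cochain P N n, δ n (n + 1) z = 0 →
      ∃ w : Cochain P N (n - 1), δ (n - 1) n w = z := by
  rw [HomologicalComplex.exactAt_iff' _ (n - 1) n (n + 1) (by simp) (by simp),
    ShortComplex.ab_exact_iff]
  rfl

variable {T : Type u} [AddCommGroup T]

lemma quasiIsoAt_zero_iff_bijective
    (φ : (HomologicalComplex.single AddCommGrpCat.{u} (ComplexShape.up ℤ) 0).obj
        (AddCommGrpCat.of T) ⟶ HomComplex P N) (β : T →+ Cocycle P N 0)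
    (hφ : φ.f 0 = (HomologicalComplex.singleObjXSelf (ComplexShape.up ℤ) 0
      (AddCommGrpCat.of T)).hom ≫
        AddCommGrpCat.ofHom ((Cocycle.toCochainAddMonoidHom P N 0).comp β)) :
    QuasiIsoAt φ 0 ↔ Function.Bijective (fun t => CohomologyClass.mk (β t)) := by
  rw [quasiIsoAt_iff]
  let e := HomologicalComplex.singleObjXSelf (ComplexShape.up ℤ) 0 (AddCommGrpCat.of T)
  -- The differentials around degree zero vanish, so the homology of the source is `T`; that of the
  -- target is cocycles modulo coboundaries.
  let h₁ : (((HomologicalComplex.single AddCommGrpCat.{u} (ComplexShape.up ℤ) 0).obj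
        (AddCommGrpCat.of T)).sc 0).LeftHomologyData :=
    ShortComplex.LeftHomologyData.ofZeros _ rfl rfl
  let φK : h₁.K ⟶ (leftHomologyData P N 0).K := e.hom ≫ AddCommGrpCat.ofHom β
  let φH : h₁.H ⟶ (leftHomologyData P N 0).H :=
    e.hom ≫ AddCommGrpCat.ofHom ((CohomologyClass.mkAddMonoidHom P N 0).comp β)
  have commi : φK ≫ (leftHomologyData P N 0).i = h₁.i ≫
      ((HomologicalComplex.shortComplexFunctor AddCommGrpCat.{u} (ComplexShape.up ℤ) 0).map φ).τ₂ := by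
    refine Eq.trans ?_ ((Category.id_comp (φ.f 0)).trans hφ).symm
    exact Category.assoc e.hom (AddCommGrpCat.ofHom β)
      (AddCommGrpCat.ofHom (Cocycle.toCochainAddMonoidHom P N 0))
  have commπ : h₁.π ≫ φH = φK ≫ (leftHomologyData P N 0).π :=
    (Category.id_comp φH).trans (Category.assoc e.hom (AddCommGrpCat.ofHom β)
      (AddCommGrpCat.ofHom (CohomologyClass.mkAddMonoidHom P N 0))).symm
  let γ : ShortComplex.LeftHomologyMapData
      ((HomologicalComplex.shortComplexFunctor AddCommGrpCat.{u} (ComplexShape.up ℤ) 0).map φ)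
        h₁ (leftHomologyData P N 0) :=
    { φK := φK
      φH := φH
      commi := commi
      commf' := by
        rw [← cancel_mono (leftHomologyData P N 0).i, Category.assoc, commi, ← Category.assoc,
          h₁.f'_i, Category.assoc, (leftHomologyData P N 0).f'_i]
        exact ((HomologicalComplex.shortComplexFunctor AddCommGrpCat.{u}
          (ComplexShape.up ℤ) 0).map φ).comm₁₂.symm
      commπ := commπ }
  have hφH : IsIso φH ↔
      IsIso (AddCommGrpCat.ofHom ((CohomologyClass.mkAddMonoidHom P N 0).comp β)) :=
    isIso_comp_left_iff e.hom _
  rw [γ.quasiIso_iff]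
  refine hφH.trans ?_
  rw [ConcreteCategory.isIso_iff_bijective]
  rfl

/-- Away from degree zero the source is exact, so the target must be. In degree zero the map onto
cohomology classes must be bijective; by additivity, injectivity is triviality of the kernel. -/
lemma quasiIso_iff_representsHom
    (φ : (HomologicalComplex.single AddCommGrpCat.{u} (ComplexShape.up ℤ) 0).obj
        (AddCommGrpCat.of T) ⟶ HomComplex P N) (β : T →+ (P ⟶ N))
    (hφ : φ.f 0 = (HomologicalComplex.singleObjXSelf (ComplexShape.up ℤ) 0
      (AddCommGrpCat.of T)).hom ≫ AddCommGrpCat.ofHom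
        ((Cocycle.toCochainAddMonoidHom P N 0).comp (Cocycle.equivHom P N |>.toAddMonoidHom.comp β))) :
    QuasiIso φ ↔ RepresentsHom β := by
  have h0 := quasiIsoAt_zero_iff_bijective φ _ hφ
  have hn : ∀ n : ℤ, n ≠ 0 → (QuasiIsoAt φ n ↔ ∀ z : Cochain P N n, δ n (n + 1) z = 0 →
      ∃ w : Cochain P N (n - 1), δ (n - 1) n w = z) := fun n hn => by
    rw [quasiIsoAt_iff_exactAt, exactAt_homComplex_iff]
    exact HomologicalComplex.exactAt_single_obj _ _ _ _ hn
  have key : ∀ z : Cocycle P N 0, CohomologyClass.mk z = 0 ↔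
      ∃ w : Cochain P N (-1), δ (-1) 0 w = z := fun z => by
    rw [CohomologyClass.mk_eq_zero_iff, mem_coboundaries_iff _ (-1) (by simp)]
  have hb : Function.Bijective (fun t => CohomologyClass.mk
      ((Cocycle.equivHom P N |>.toAddMonoidHom.comp β) t)) ↔
      (∀ u : P ⟶ N, ∃ t, ∃ w : Cochain P N (-1),
        Cochain.ofHom u = Cochain.ofHom (β t) + δ (-1) 0 w) ∧
      ∀ t, (∃ w : Cochain P N (-1), Cochain.ofHom (β t) = δ (-1) 0 w) → t = 0 := by
    rw [Function.Bijective, and_comm]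
    refine and_congr ⟨fun h u => ?_, fun h x => ?_⟩ ?_
    · obtain ⟨t, ht⟩ := h (CohomologyClass.mk (Cocycle.ofHom u))
      have ht' := (key (Cocycle.ofHom u - Cocycle.ofHom (β t))).1
        (by rw [CohomologyClass.mk_sub, sub_eq_zero]; exact ht.symm)
      obtain ⟨w, hw⟩ := ht'
      exact ⟨t, w, by rw [hw]; simp⟩
    · obtain ⟨z, rfl⟩ := x.mk_surjective
      obtain ⟨u, rfl⟩ := (Cocycle.equivHom P N).surjective z
      obtain ⟨t, w, hw⟩ := h u
      refine ⟨t, ?_⟩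
      have : CohomologyClass.mk (Cocycle.ofHom u - Cocycle.ofHom (β t)) = 0 :=
        (key _).2 ⟨w, by simp [hw]⟩
      rw [CohomologyClass.mk_sub, sub_eq_zero] at this
      exact this.symm
    · let F : T →+ CohomologyClass P N 0 := (CohomologyClass.mkAddMonoidHom P N 0).comp
        (Cocycle.equivHom P N |>.toAddMonoidHom.comp β)
      change Function.Injective F ↔ _
      rw [injective_iff_map_eq_zero]
      refine forall_congr' fun t => imp_congr ?_ Iff.rfl
      refine (key (Cocycle.ofHom (β t))).trans (exists_congr fun w => ?_)
      exact eq_comm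
  rw [quasiIso_iff]
  constructor
  · intro h
    obtain ⟨h1, h2⟩ := hb.1 (h0.1 (h 0))
    exact ⟨fun n hn' => (hn n hn').1 (h n), h1, h2⟩
  · intro h n
    by_cases hn' : n = 0
    · subst hn'
      exact h0.2 (hb.2 ⟨h.surj, h.inj⟩)
    · exact (hn n hn').2 (h.exact n hn')

end HomComplexHomology

section Multiplication

variable {E S T : Type u} [Ring E] [Ring S] [Ring T]
  (f : S →+* E) (g : T →+* E) (h : ∀ s t, Commute (f s) (g t))

lemma quasiIso_mulMap_iff (M : CochainComplex (ModuleCat.{u} E) ℤ)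
    (P : CochainComplex (ModuleCat.{u} S) ℤ)
    (p : P ⟶ ((ModuleCat.restrictScalars f).mapHomologicalComplex _).obj M) :
    QuasiIso (mulMap f g h M P p) ↔ RepresentsHom fun t => p ≫ actComplex f g h t M := by
  let β : T →+ (P ⟶ ((ModuleCat.restrictScalars f).mapHomologicalComplex _).obj M) :=
    AddMonoidHom.mk' (fun t => p ≫ actComplex f g h t M) fun t t' => by
      ext i x
      change g (t + t') • (show M.X i from p.f i x) =
        g t • (show M.X i from p.f i x) + g t' • (show M.X i from p.f i x)
      rw [map_add, add_smul]
  refine quasiIso_iff_representsHom _ β ?_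
  exact HomologicalComplex.mkHomFromSingle_f _ _

end Multiplication

/-! ### Independence of the K-projective resolution -/

section KProjective

variable {C : Type*} [Category* C] [Abelian C] [HasDerivedCategory C]
  {P N : CochainComplex C ℤ}

open DerivedCategory

/-- Out of a K-projective complex, homotopy classes and derived morphisms agree, and a null-homotopy
is a cochain of degree `-1`. -/
lemma Q_map_eq_zero_iff [P.IsKProjective] (u : P ⟶ N) :
    Q.map u = 0 ↔ ∃ w : Cochain P N (-1), Cochain.ofHom u = δ (-1) 0 w := by
  have h : Q.map u = 0 ↔ (HomotopyCategory.quotient C (.up ℤ)).map u = 0 := by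
    constructor
    · intro hu
      apply (IsKProjective.Qh_map_bijective P _).injective
      rw [Functor.map_zero, ← cancel_mono ((quotientCompQhIso C).hom.app N),
        quotientCompQhIso_hom_naturality, hu]
      simp
    · intro hu
      rw [← cancel_epi ((quotientCompQhIso C).hom.app P), ← quotientCompQhIso_hom_naturality, hu]
      simp
  rw [h, HomotopyCategory.quotient_map_eq_zero_iff]
  constructor
  · rintro ⟨H⟩
    obtain ⟨w, hw⟩ := Cochain.equivHomotopy _ _ H
    exact ⟨w, by simpa using hw⟩
  · rintro ⟨w, hw⟩
    exact ⟨(Cochain.equivHomotopy _ _).symm ⟨w, by simpa using hw⟩⟩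

lemma Q_map_surjective_of_isKProjective [P.IsKProjective] (x : Q.obj P ⟶ Q.obj N) :
    ∃ u : P ⟶ N, Q.map u = x := by
  obtain ⟨y, hy⟩ := (IsKProjective.Qh_map_bijective P _).surjective
    ((quotientCompQhIso C).hom.app P ≫ x ≫ (quotientCompQhIso C).inv.app N)
  obtain ⟨u, rfl⟩ := (HomotopyCategory.quotient C (.up ℤ)).map_surjective y
  refine ⟨u, ?_⟩
  rw [← cancel_epi ((quotientCompQhIso C).hom.app P), ← quotientCompQhIso_hom_naturality, hy]
  simp

/-- The right-hand side depends on `P` only through its image in the derived category, so the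
resolution can be exchanged. -/
lemma cochain_exact_iff [P.IsKProjective] (n : ℤ) :
    (∀ z : Cochain P N n, δ n (n + 1) z = 0 →
      ∃ w : Cochain P N (n - 1), δ (n - 1) n w = z) ↔
    ∀ x : Q.obj P ⟶ Q.obj (N⟦n⟧), x = 0 := by
  have h1 : (∀ z : Cochain P N n, δ n (n + 1) z = 0 →
      ∃ w : Cochain P N (n - 1), δ (n - 1) n w = z) ↔ ∀ y : CohomologyClass P N n, y = 0 := by
    constructor
    · intro h y
      obtain ⟨z, rfl⟩ := y.mk_surjective
      rw [CohomologyClass.mk_eq_zero_iff, mem_coboundaries_iff _ (n - 1) (by simp)]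
      exact h z (z.δ_eq_zero _)
    · intro h z hz
      have := h (CohomologyClass.mk (Cocycle.mk z (n + 1) rfl hz))
      rwa [CohomologyClass.mk_eq_zero_iff, mem_coboundaries_iff _ (n - 1) (by simp)] at this
  rw [h1]
  constructor
  · intro h x
    obtain ⟨u, rfl⟩ := Q_map_surjective_of_isKProjective x
    have : (HomotopyCategory.quotient C (.up ℤ)).map u = 0 := by
      obtain ⟨y, hy⟩ := (CohomologyClass.toHom_bijective P N n).surjective
        ((HomotopyCategory.quotient C (.up ℤ)).map u)
      rw [← hy, h y, map_zero]
    rw [← cancel_epi ((quotientCompQhIso C).hom.app P), ← quotientCompQhIso_hom_naturality, this]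
    simp
  · intro h y
    apply (CohomologyClass.toHom_bijective P N n).injective
    apply (IsKProjective.Qh_map_bijective P _).injective
    rw [map_zero, Functor.map_zero, ← cancel_epi ((quotientCompQhIso C).inv.app P),
      ← cancel_mono ((quotientCompQhIso C).hom.app _)]
    exact (h _).trans (h _).symm

end KProjective

section Independence

variable {C : Type*} [Category* C] [Abelian C] {N P P' : CochainComplex C ℤ}

open DerivedCategory

/-- Whether a family of endomorphisms represents derived endomorphisms does not depend on the
resolution. -/
lemma RepresentsHom.of_quasiIso {T : Type*} [AddCommGroup T] (α : T → (N ⟶ N))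
    [P.IsKProjective] [P'.IsKProjective] (p : P ⟶ N) (p' : P' ⟶ N) [QuasiIso p] [QuasiIso p']
    (hp : RepresentsHom fun t => p ≫ α t) : RepresentsHom fun t => p' ≫ α t := by
  let := HasDerivedCategory.standard C
  refine ⟨fun n hn => ?_, fun u => ?_, fun t ht => hp.inj t ?_⟩
  · have h := hp.exact n hn
    rw [cochain_exact_iff] at h ⊢
    intro x
    -- This composite is the isomorphism between the two resolutions in the derived category.
    rw [← cancel_epi (Q.map p ≫ inv (Q.map p'))]
    exact (h _).trans (h _).symm
  · obtain ⟨v, hv⟩ := Q_map_surjective_of_isKProjective (Q.map p ≫ inv (Q.map p') ≫ Q.map u)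
    obtain ⟨t, ht⟩ := hp.surj v
    refine ⟨t, ?_⟩
    have h1 : Q.map (v - p ≫ α t) = 0 := by
      rw [Q_map_eq_zero_iff]
      obtain ⟨w, hw⟩ := ht
      exact ⟨w, by rw [Cochain.ofHom_sub, hw]; simp⟩
    have h2 : Q.map (u - p' ≫ α t) = 0 := by
      rw [← cancel_epi (Q.map p ≫ inv (Q.map p'))]
      rw [Functor.map_sub, hv] at h1
      simpa [Preadditive.comp_sub] using h1
    obtain ⟨w, hw⟩ := (Q_map_eq_zero_iff _).1 h2
    exact ⟨w, by rw [← hw, Cochain.ofHom_sub]; simp⟩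
  · rw [← Q_map_eq_zero_iff] at ht ⊢
    rw [← cancel_epi (Q.map p' ≫ inv (Q.map p))]
    simpa using ht

end Independence

section

variable {C : Type*} [Category* C] [Preadditive C] {P N N' : CochainComplex C ℤ}

lemma RepresentsHom.postcomp_iso {T : Type*} [Zero T] {β : T → (P ⟶ N)}
    (hβ : RepresentsHom β) (e : N ≅ N') : RepresentsHom fun t => β t ≫ e.hom := by
  have hc : ∀ {n : ℤ} (z : Cochain P N' n),
      (z.comp (Cochain.ofHom e.inv) (add_zero n)).comp (Cochain.ofHom e.hom) (add_zero n) = z := by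
    intro n z
    rw [Cochain.comp_assoc_of_second_is_zero_cochain, ← Cochain.ofHom_comp, e.inv_hom_id]
    exact Cochain.comp_id z
  refine ⟨fun n hn z hz => ?_, fun u => ?_, fun t ⟨w, hw⟩ => hβ.inj t ?_⟩
  · obtain ⟨w, hw⟩ := hβ.exact n hn (z.comp (Cochain.ofHom e.inv) (add_zero n)) (by
      rw [δ_comp_ofHom, hz, Cochain.zero_comp])
    exact ⟨w.comp (Cochain.ofHom e.hom) (add_zero _), by rw [δ_comp_ofHom, hw, hc]⟩
  · obtain ⟨t, w, hw⟩ := hβ.surj (u ≫ e.inv)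
    refine ⟨t, w.comp (Cochain.ofHom e.hom) (add_zero _), ?_⟩
    rw [δ_comp_ofHom, Cochain.ofHom_comp, ← Cochain.add_comp, ← hw, ← Cochain.ofHom_comp]
    simp
  · refine ⟨w.comp (Cochain.ofHom e.inv) (add_zero _), ?_⟩
    rw [δ_comp_ofHom, ← hw, ← Cochain.ofHom_comp]
    simp

end

/-! ### Clearing denominators in Hom modules -/

section LocalGlobal

/-- The ideal of all `a` with `a • z ∈ U` lies in no maximal ideal, so it contains `1`. -/
lemma mem_of_forall_maximal {R V : Type*} [CommRing R] [AddCommGroup V] [Module R V]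
    (U : Submodule R V) (z : V)
    (h : ∀ (m : Ideal R) [m.IsMaximal], ∃ a ∈ m.primeCompl, a • z ∈ U) : z ∈ U := by
  by_contra hz
  let I : Ideal R := U.comap (LinearMap.toSpanSingleton R V z)
  have hI : I ≠ ⊤ := fun hI => hz (by
    have : (1 : R) ∈ I := hI ▸ Submodule.mem_top
    simpa [I] using this)
  obtain ⟨m, hm, hIm⟩ := Ideal.exists_le_maximal I hI
  obtain ⟨a, ha, haz⟩ := h m
  exact ha (hIm (by simpa [I] using haz))

variable {R S X Y Y' : Type*} [CommRing R] [Ring S] [Algebra R S]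
  [AddCommGroup X] [Module S X] [Module R X] [IsScalarTower R S X]
  [AddCommGroup Y] [Module S Y] [Module R Y] [IsScalarTower R S Y]
  [AddCommGroup Y'] [Module S Y'] [Module R Y'] [IsScalarTower R S Y']
  (W : Submonoid R)

/-- A map that vanishes after localization is killed by a denominator. -/
lemma exists_smul_eq_zero_of_isLocalizedModule [Module.Finite S X] [Module.Finite R S]
    (l : Y →ₗ[S] Y') [IsLocalizedModule W (l.restrictScalars R)] (σ : X →ₗ[S] Y)
    (h : l ∘ₗ σ = 0) : ∃ a ∈ W, a • σ = 0 := by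
  have : Module.Finite R X := Module.Finite.trans S X
  have key : ∀ x, ∃ a : W, a • σ x = 0 := fun x => by
    have hx : l.restrictScalars R (σ x) = l.restrictScalars R 0 := by
      simpa using LinearMap.congr_fun h x
    obtain ⟨c, hc⟩ := IsLocalizedModule.exists_of_eq (S := W) hx
    exact ⟨c, by simpa using hc⟩
  choose a ha using key
  obtain ⟨s, hs⟩ := Module.finite_def.1 ‹Module.Finite R X›
  -- One denominator for each of finitely many `R`-generators of `X`.
  refine ⟨∏ x ∈ s, (a x : R), prod_mem fun x _ => (a x).2, ?_⟩
  have hz : (∏ x ∈ s, (a x : R)) • (σ.restrictScalars R) = 0 := by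
    refine LinearMap.ext_on hs fun x hx => ?_
    classical
    rw [LinearMap.smul_apply, ← Finset.prod_erase_mul s _ (Finset.mem_coe.1 hx), mul_smul]
    have : (a x : R) • σ x = 0 := ha x
    simp [this]
  ext x
  exact LinearMap.congr_fun hz x

/-- A map into a localization becomes integral after multiplication by a denominator. -/
lemma exists_lift_of_isLocalizedModule [IsNoetherianRing R] [Module.Finite S X]
    [Module.Finite R S] (l : Y →ₗ[S] Y') [IsLocalizedModule W (l.restrictScalars R)]
    (ψ : X →ₗ[S] Y') : ∃ (σ : X →ₗ[S] Y), ∃ a ∈ W, l ∘ₗ σ = a • ψ := by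
  have : Module.Finite R X := Module.Finite.trans S X
  have : Module.FinitePresentation R X := Module.finitePresentation_of_finite R X
  obtain ⟨σ, a, ha⟩ := Module.FinitePresentation.exists_lift_of_isLocalizedModule W
    (l.restrictScalars R) (ψ.restrictScalars R)
  have ha' : ∀ x, l (σ x) = a • ψ x := fun x => LinearMap.congr_fun ha x
  have : IsLocalizedModule W ((l.restrictScalars R).restrictScalars R) :=
    ‹IsLocalizedModule W (l.restrictScalars R)›
  have key : ∀ s : S, ∃ b ∈ W, ∀ x, b • σ (s • x) = b • s • σ x := fun s => by
    -- The lift `σ` is only `R`-linear. Its failure to commute with `s` dies under `l`, because `l ∘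
    -- σ = a • ψ` is `S`-linear, so a denominator kills it.
    let φ : X →ₗ[R] Y := σ ∘ₗ (Algebra.lsmul R R X s) - (Algebra.lsmul R R Y s) ∘ₗ σ
    obtain ⟨b, hb, hφ⟩ := exists_smul_eq_zero_of_isLocalizedModule (R := R) (S := R) W
      (l.restrictScalars R) φ (by
        ext x
        have := ψ.map_smul s x
        simp [φ, ha', this, Submonoid.smul_def, smul_algebra_smul_comm])
    refine ⟨b, hb, fun x => ?_⟩
    have := LinearMap.congr_fun hφ x
    simpa [φ, smul_sub, sub_eq_zero] using this
  choose b hb hbs using key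
  obtain ⟨t, ht⟩ := Module.finite_def.1 ‹Module.Finite R S›
  -- Finitely many `R`-generators of `S` suffice: the `s` with which `σ` commutes up to `c` form an
  -- `R`-submodule.
  let c : R := ∏ s ∈ t, b s
  have hc : ∀ s x, c • σ (s • x) = c • s • σ x := fun s x => by
    have hs : s ∈ Submodule.span R (t : Set S) := ht ▸ Submodule.mem_top
    induction hs using Submodule.span_induction with
    | mem s hs =>
      classical
      have : c = (∏ x ∈ t.erase s, b x) * b s := (Finset.prod_erase_mul t _ hs).symm
      rw [this, mul_smul, hbs, mul_smul]
    | zero => simp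
    | add s s' _ _ h h' => simp only [add_smul, map_add, smul_add, h, h']
    | smul r s _ h =>
      rw [smul_assoc, map_smul, smul_comm, h, smul_comm, smul_assoc]
  refine ⟨{ toFun := fun x => c • σ x
            map_add' := by simp
            map_smul' := fun s x => by
              simp only [RingHom.id_apply]
              rw [hc, smul_algebra_smul_comm] }, c * a,
    mul_mem (prod_mem fun s _ => hb s) a.2, ?_⟩
  ext x
  have h1 : l (c • σ x) = c • l (σ x) := (l.restrictScalars R).map_smul c (σ x)
  simp only [LinearMap.comp_apply, LinearMap.coe_mk, AddHom.coe_mk, LinearMap.smul_apply]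
  rw [h1, ha', mul_smul]
  rfl

end LocalGlobal

/-! ### Clearing denominators in cochains and the local-global principle -/

section Linear

variable {R S : Type u} [CommRing R] [Ring S] [Algebra R S]

/-- The underlying `R`-module of a module over an `R`-algebra. -/
@[reducible] def algBase (X : ModuleCat.{u} S) : Module R X :=
  Module.restrictScalars R S X

attribute [local instance] algBase

lemma algBase_tower (X : ModuleCat.{u} S) : IsScalarTower R S X :=
  IsScalarTower.restrictScalars R S X

attribute [local instance] algBase_tower

variable (R S) in
/-- Modules over an `R`-algebra form an `R`-linear category. -/
@[reducible] def linearModuleCat : Linear R (ModuleCat.{u} S) where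
  homModule _ _ := inferInstance

attribute [local instance] linearModuleCat

variable {P N N' : CochainComplex (ModuleCat.{u} S) ℤ} (W : Submonoid R)

lemma cochain_exists_smul_eq_zero [Module.Finite R S]
    (hP : ∃ a b : ℤ, ∀ i, i < a ∨ b < i → Limits.IsZero (P.X i))
    (hfin : ∀ i, Module.Finite S (P.X i)) (l : N ⟶ N')
    (hl : ∀ i, IsLocalizedModule W ((l.f i).hom.restrictScalars R)) {n : ℤ} (σ : Cochain P N n)
    (h : σ.comp (Cochain.ofHom l) (add_zero n) = 0) : ∃ a ∈ W, a • σ = 0 := by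
  have key : ∀ p : ℤ, ∃ a ∈ W, a • σ.v p (p + n) rfl = 0 := fun p => by
    have := hfin p
    have := hl (p + n)
    obtain ⟨a, ha, h0⟩ := exists_smul_eq_zero_of_isLocalizedModule W (l.f (p + n)).hom
      (σ.v p (p + n) rfl).hom (by
        have := Cochain.congr_v h p (p + n) rfl
        rw [Cochain.comp_zero_cochain_v, Cochain.ofHom_v] at this
        exact congrArg ModuleCat.Hom.hom this)
    exact ⟨a, ha, ModuleCat.hom_ext h0⟩
  choose a ha h0 using key
  obtain ⟨c, d, hcd⟩ := hP
  refine ⟨∏ p ∈ Finset.Icc c d, a p, prod_mem fun p _ => ha p, ?_⟩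
  ext1 p q hpq
  subst hpq
  by_cases hp : p ∈ Finset.Icc c d
  · rw [Cochain.smul_v, ← Finset.prod_erase_mul _ _ hp, mul_smul, h0, smul_zero]
    rfl
  · exact (hcd p (by simp at hp; grind)).eq_of_src _ _

lemma cochain_exists_lift [IsNoetherianRing R] [Module.Finite R S]
    (hP : ∃ a b : ℤ, ∀ i, i < a ∨ b < i → Limits.IsZero (P.X i))
    (hfin : ∀ i, Module.Finite S (P.X i)) (l : N ⟶ N')
    (hl : ∀ i, IsLocalizedModule W ((l.f i).hom.restrictScalars R)) {n : ℤ} (ψ : Cochain P N' n) :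
    ∃ σ : Cochain P N n, ∃ a ∈ W, σ.comp (Cochain.ofHom l) (add_zero n) = a • ψ := by
  have key : ∀ p : ℤ, ∃ σ : P.X p ⟶ N.X (p + n), ∃ a ∈ W,
      σ ≫ l.f (p + n) = a • ψ.v p (p + n) rfl := fun p => by
    have := hfin p
    have := hl (p + n)
    obtain ⟨σ, a, ha, h0⟩ := exists_lift_of_isLocalizedModule W (l.f (p + n)).hom
      (ψ.v p (p + n) rfl).hom
    exact ⟨ModuleCat.ofHom σ, a, ha, ModuleCat.hom_ext h0⟩
  choose σ a ha h0 using key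
  obtain ⟨c, d, hcd⟩ := hP
  classical
  -- Component `p` already carries the denominator `a p`; the remaining factors bring every
  -- component to the common denominator.
  refine ⟨Cochain.mk fun p q hpq =>
    (∏ i ∈ (Finset.Icc c d).erase p, a i) • (σ p ≫ eqToHom (by rw [hpq])),
    ∏ p ∈ Finset.Icc c d, a p, prod_mem fun p _ => ha p, ?_⟩
  ext1 p q hpq
  subst hpq
  by_cases hp : p ∈ Finset.Icc c d
  · rw [Cochain.smul_v, ← Finset.prod_erase_mul _ _ hp, mul_smul, ← h0]
    simp
  · exact (hcd p (by simp at hp; grind)).eq_of_src _ _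

/-- Representability of derived homomorphisms may be checked locally. -/
theorem RepresentsHom.of_localization [IsNoetherianRing R] [Module.Finite R S]
    {T : Type u} [AddCommGroup T] [Module R T]
    (hP : ∃ a b : ℤ, ∀ i, i < a ∨ b < i → Limits.IsZero (P.X i))
    (hfin : ∀ i, Module.Finite S (P.X i)) (β : T →ₗ[R] (P ⟶ N))
    (H : ∀ (m : Ideal R) [m.IsMaximal],
      ∃ (N' : CochainComplex (ModuleCat.{u} S) ℤ) (l : N ⟶ N') (T' : Type u)
        (_ : AddCommGroup T') (_ : Module R T') (τ : T →ₗ[R] T') (β' : T' →ₗ[R] (P ⟶ N')),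
        (∀ i, IsLocalizedModule m.primeCompl ((l.f i).hom.restrictScalars R)) ∧
        IsLocalizedModule m.primeCompl τ ∧ (∀ t, β t ≫ l = β' (τ t)) ∧ RepresentsHom β') :
    RepresentsHom β := by
  refine ⟨fun n hn z hz => ?_, fun u => ?_, fun t ⟨w, hw⟩ => ?_⟩
  · suffices z ∈ LinearMap.range (δ_hom R P N (n - 1) n) from this
    refine mem_of_forall_maximal _ z fun m hm => ?_
    obtain ⟨N', l, T', _, _, τ, β', hl, hτ, hβ, hR⟩ := H m
    obtain ⟨w', hw'⟩ := hR.exact n hn (z.comp (Cochain.ofHom l) (add_zero n))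
      (by rw [δ_comp_ofHom, hz, Cochain.zero_comp])
    obtain ⟨σ, a, ha, hσ⟩ := cochain_exists_lift m.primeCompl hP hfin l hl w'
    -- `δ σ` and `a • z` have the same image in `N'`, so they agree after multiplication by some
    -- `b`.
    obtain ⟨b, hb, h0⟩ := cochain_exists_smul_eq_zero m.primeCompl hP hfin l hl
      (δ (n - 1) n σ - a • z) (by
        rw [Cochain.sub_comp, ← δ_comp_ofHom, hσ, δ_smul, hw', Cochain.smul_comp, sub_self])
    refine ⟨b * a, mul_mem hb ha, b • σ, ?_⟩
    rw [smul_sub, sub_eq_zero] at h0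
    simpa [mul_smul] using h0
  · let B : T →ₗ[R] Cochain P N 0 :=
      { toFun := fun t => Cochain.ofHom (β t)
        map_add' := fun t t' => by rw [map_add, Cochain.ofHom_add]
        map_smul' := fun r t => by
          rw [map_smul]
          ext p
          simp }
    -- Being homotopic to some `β t` means lying in the sum of the image of `β` and the
    -- coboundaries.
    suffices Cochain.ofHom u ∈ LinearMap.range (B.coprod (δ_hom R P N (-1) 0)) by
      obtain ⟨⟨t, w⟩, h⟩ := this
      exact ⟨t, w, h.symm⟩
    refine mem_of_forall_maximal _ _ fun m hm => ?_
    obtain ⟨N', l, T', _, _, τ, β', hl, hτ, hβ, hR⟩ := H m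
    obtain ⟨t', w', hw'⟩ := hR.surj (u ≫ l)
    obtain ⟨σ, a, ha, hσ⟩ := cochain_exists_lift m.primeCompl hP hfin l hl w'
    obtain ⟨⟨t, c⟩, ht⟩ := IsLocalizedModule.surj m.primeCompl τ t'
    have ht' : τ t = (c : R) • t' := ht.symm
    -- Here `c` is the denominator of `t'` and `a` that of `w'`, so the local relation is scaled by
    -- `c * a`.
    obtain ⟨b, hb, h0⟩ := cochain_exists_smul_eq_zero m.primeCompl hP hfin l hl
      (B (a • t) + (c : R) • δ (-1) 0 σ - ((c : R) * a) • Cochain.ofHom u) (by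
        have h1 : (B (a • t)).comp (Cochain.ofHom l) (add_zero 0) =
            ((c : R) * a) • Cochain.ofHom (β' t') := by
          change (Cochain.ofHom (β (a • t))).comp _ _ = _
          rw [← Cochain.ofHom_comp, hβ, map_smul, map_smul, ht', map_smul, smul_smul, mul_comm]
          ext p
          simp
        rw [Cochain.sub_comp, Cochain.add_comp, h1, Cochain.smul_comp, Cochain.smul_comp,
          ← δ_comp_ofHom, hσ, δ_smul, ← Cochain.ofHom_comp, hw', smul_add, mul_smul, mul_smul,
          sub_self])
    refine ⟨b * (c * a), mul_mem hb (mul_mem c.2 ha), (b • a • t, b • (c : R) • σ), ?_⟩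
    rw [smul_sub, sub_eq_zero] at h0
    rw [mul_smul, ← h0]
    simp
  · suffices t ∈ (⊥ : Submodule R T) by simpa using this
    refine mem_of_forall_maximal _ t fun m hm => ?_
    obtain ⟨N', l, T', _, _, τ, β', hl, hτ, hβ, hR⟩ := H m
    have h0 : τ t = 0 := hR.inj _ ⟨w.comp (Cochain.ofHom l) (add_zero _), by
      rw [δ_comp_ofHom, ← hw, ← Cochain.ofHom_comp, hβ]⟩
    obtain ⟨c, hc⟩ := IsLocalizedModule.exists_of_eq (S := m.primeCompl) (f := τ) (x₁ := t)
      (x₂ := 0) (by rw [h0, map_zero])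
    rw [smul_zero] at hc
    exact ⟨c, c.2, hc⟩

end Linear

/-! ### Base change and its adjunction with restriction of scalars -/

section BaseChange

variable {R A S S' : Type u} [CommRing R] [CommRing A] [Algebra R A] [Ring S] [Algebra R S]
  [Ring S'] (e : S' ≃+* A ⊗[R] S)

attribute [local instance] algBase algBase_tower linearModuleCat

variable (A) in
/-- The action of `A ⊗ S` on `A ⊗ X`, for an `S`-module `X`. -/
def baseChangeAct (X : ModuleCat.{u} S) : A ⊗[R] S →ₐ[A] Module.End A (A ⊗[R] X) :=
  Algebra.TensorProduct.lift (Algebra.ofId _ _)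
    ((Module.End.baseChangeHom R A X).comp (Algebra.lsmul R R X))
    (fun r _ => Algebra.commutes r _)

lemma baseChangeAct_tmul (X : ModuleCat.{u} S) (a b : A) (s : S) (x : X) :
    baseChangeAct A X (a ⊗ₜ[R] s) (b ⊗ₜ[R] x) = (a * b) ⊗ₜ[R] (s • x) := by
  change a • (b ⊗ₜ[R] (s • x)) = _
  rw [smul_tmul', smul_eq_mul]

/-- The base change `A ⊗ X` of an `S`-module, as a module over `S' ≃ A ⊗ S`. -/
def baseChangeObj (X : ModuleCat.{u} S) : ModuleCat.{u} S' :=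
  letI : Module S' (A ⊗[R] X) :=
    Module.compHom (A ⊗[R] X) ((baseChangeAct A X).toRingHom.comp (e : S' →+* A ⊗[R] S))
  ModuleCat.of S' (A ⊗[R] X)

/-- The elements of `A ⊗ X` in the base change. -/
def toBaseChange (X : ModuleCat.{u} S) : A ⊗[R] X ≃+ baseChangeObj e X := AddEquiv.refl _

lemma smul_toBaseChange (X : ModuleCat.{u} S) (s : S') (y : A ⊗[R] X) :
    s • toBaseChange e X y = toBaseChange e X (baseChangeAct A X (e s) y) := rfl

lemma symm_smul_toBaseChange (X : ModuleCat.{u} S) (a b : A) (s : S) (x : X) :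
    e.symm (a ⊗ₜ s) • toBaseChange e X (b ⊗ₜ x) = toBaseChange e X ((a * b) ⊗ₜ (s • x)) := by
  rw [smul_toBaseChange, RingEquiv.apply_symm_apply, baseChangeAct_tmul]

/-- The structure map `S → S' ≃ A ⊗ S`. -/
def baseChangeRingHom : S →+* S' :=
  (e.symm : A ⊗[R] S →+* S').comp
    (Algebra.TensorProduct.includeRight : S →ₐ[R] A ⊗[R] S).toRingHom

lemma baseChangeRingHom_apply (s : S) : baseChangeRingHom e s = e.symm (1 ⊗ₜ s) := rfl

lemma baseChange_induction {motive : S' → Prop} (s : S')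
    (tmul : ∀ (a : A) (t : S), motive (e.symm (a ⊗ₜ t)))
    (add : ∀ s t, motive s → motive t → motive (s + t)) : motive s := by
  obtain ⟨y, rfl⟩ := e.symm.surjective s
  induction y using TensorProduct.induction_on with
  | zero => simpa using tmul 0 0
  | tmul a t => exact tmul a t
  | add y z hy hz => rw [map_add]; exact add _ _ hy hz

lemma toBaseChange_induction {X : ModuleCat.{u} S} {motive : baseChangeObj e X → Prop}
    (y : baseChangeObj e X)
    (tmul : ∀ (a : A) (x : X), motive (toBaseChange e X (a ⊗ₜ x)))
    (add : ∀ s t, motive s → motive t → motive (s + t)) : motive y := by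
  obtain ⟨y, rfl⟩ := (toBaseChange e X).surjective y
  induction y using TensorProduct.induction_on with
  | zero => simpa using tmul 0 0
  | tmul a t => exact tmul a t
  | add y z hy hz => rw [map_add]; exact add _ _ hy hz

/-- The canonical map `X → A ⊗ X`. -/
def baseChangeUnit (X : ModuleCat.{u} S) :
    X ⟶ (ModuleCat.restrictScalars (baseChangeRingHom e)).obj (baseChangeObj e X) :=
  ModuleCat.ofHom (Y := (ModuleCat.restrictScalars (baseChangeRingHom e)).obj (baseChangeObj e X))
    { toFun := fun x => toBaseChange e X (1 ⊗ₜ x)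
      map_add' := fun x y => by rw [tmul_add, map_add]; rfl
      map_smul' := fun s x => by
        change _ = baseChangeRingHom e s • toBaseChange e X (1 ⊗ₜ x)
        rw [baseChangeRingHom_apply, symm_smul_toBaseChange, one_mul] }

lemma smul_baseChangeUnit (X : ModuleCat.{u} S) (a : A) (x : X) :
    e.symm (a ⊗ₜ 1) • toBaseChange e X (1 ⊗ₜ x) = toBaseChange e X (a ⊗ₜ x) := by
  rw [symm_smul_toBaseChange, mul_one, one_smul]

lemma baseChange_hom_ext {X : ModuleCat.{u} S} {Y : ModuleCat.{u} S'}
    {φ ψ : baseChangeObj e X ⟶ Y}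
    (h : ∀ x : X, φ (toBaseChange e X (1 ⊗ₜ x)) = ψ (toBaseChange e X (1 ⊗ₜ x))) : φ = ψ := by
  ext y
  induction y using toBaseChange_induction with
  | tmul a x => rw [← smul_baseChangeUnit, map_smul, map_smul, h]
  | add y z hy hz => rw [map_add, map_add, hy, hz]

/-- The underlying additive map of `baseChangeLift`. -/
def baseChangeLiftAux {X : ModuleCat.{u} S} {Y : ModuleCat.{u} S'}
    (g : X ⟶ (ModuleCat.restrictScalars (baseChangeRingHom e)).obj Y) : A ⊗[R] X →+ Y :=
  TensorProduct.liftAddHom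
    (AddMonoidHom.mk' (fun a => AddMonoidHom.mk' (fun x => e.symm (a ⊗ₜ 1) • (show Y from g x))
        (fun x y => by rw [map_add]; exact smul_add _ _ _))
      (fun a b => by
        ext x
        change e.symm ((a + b) ⊗ₜ 1) • (show Y from g x) = e.symm (a ⊗ₜ 1) • (show Y from g x) +
          e.symm (b ⊗ₜ 1) • (show Y from g x)
        rw [add_tmul, map_add, add_smul]))
    (fun r a x => by
      change e.symm ((r • a) ⊗ₜ 1) • (show Y from g x) = e.symm (a ⊗ₜ 1) • (show Y from g (r • x))
      have h : g (r • x) = algebraMap R S r • g x := by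
        rw [← algebraMap_smul S r x, map_smul]
      have h' : (show Y from g (r • x)) =
        e.symm (1 ⊗ₜ algebraMap R S r) • (show Y from g x) := h
      rw [h', smul_smul, ← map_mul, Algebra.TensorProduct.tmul_mul_tmul, mul_one, one_mul,
        Algebra.algebraMap_eq_smul_one, tmul_smul, smul_tmul'])

lemma baseChangeLiftAux_tmul {X : ModuleCat.{u} S} {Y : ModuleCat.{u} S'}
    (g : X ⟶ (ModuleCat.restrictScalars (baseChangeRingHom e)).obj Y) (a : A) (x : X) :
    baseChangeLiftAux e g (a ⊗ₜ x) = e.symm (a ⊗ₜ 1) • (show Y from g x) := rfl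

lemma baseChangeLiftAux_smul {X : ModuleCat.{u} S} {Y : ModuleCat.{u} S'}
    (g : X ⟶ (ModuleCat.restrictScalars (baseChangeRingHom e)).obj Y) (s : S')
    (y : baseChangeObj e X) :
    baseChangeLiftAux e g ((toBaseChange e X).symm (s • y)) =
      s • baseChangeLiftAux e g ((toBaseChange e X).symm y) := by
  induction s using baseChange_induction e with
  | add s t hs ht => simp only [add_smul, map_add, hs, ht]
  | tmul a t =>
    induction y using toBaseChange_induction with
    | add y z hy hz => simp only [smul_add, map_add, hy, hz]
    | tmul b x =>
      rw [symm_smul_toBaseChange, AddEquiv.symm_apply_apply, AddEquiv.symm_apply_apply,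
        baseChangeLiftAux_tmul, baseChangeLiftAux_tmul]
      have h : (show Y from g (t • x)) = e.symm (1 ⊗ₜ t) • (show Y from g x) :=
        g.hom.map_smul t x
      rw [h, smul_smul, smul_smul, ← map_mul, ← map_mul]
      simp

/-- The extension of an `S`-linear map `X → Y` to an `S'`-linear map `A ⊗ X → Y`. -/
def baseChangeLift {X : ModuleCat.{u} S} {Y : ModuleCat.{u} S'}
    (g : X ⟶ (ModuleCat.restrictScalars (baseChangeRingHom e)).obj Y) : baseChangeObj e X ⟶ Y :=
  ModuleCat.ofHom (X := baseChangeObj e X) (Y := Y)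
    { toFun := fun y => baseChangeLiftAux e g ((toBaseChange e X).symm y)
      map_add' := fun y z => by rw [map_add, map_add]
      map_smul' := fun s y => baseChangeLiftAux_smul e g s y }

lemma baseChangeLift_tmul {X : ModuleCat.{u} S} {Y : ModuleCat.{u} S'}
    (g : X ⟶ (ModuleCat.restrictScalars (baseChangeRingHom e)).obj Y) (a : A) (x : X) :
    baseChangeLift e g (toBaseChange e X (a ⊗ₜ x)) = e.symm (a ⊗ₜ 1) • (show Y from g x) := rfl

lemma baseChangeLift_one_tmul {X : ModuleCat.{u} S} {Y : ModuleCat.{u} S'}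
    (g : X ⟶ (ModuleCat.restrictScalars (baseChangeRingHom e)).obj Y) (x : X) :
    baseChangeLift e g (toBaseChange e X (1 ⊗ₜ x)) = g x := by
  rw [baseChangeLift_tmul, ← Algebra.TensorProduct.one_def, map_one, one_smul]

/-- The base change of an `S`-linear map. -/
def baseChangeMap {X Y : ModuleCat.{u} S} (φ : X ⟶ Y) : baseChangeObj e X ⟶ baseChangeObj e Y :=
  baseChangeLift e (φ ≫ baseChangeUnit e Y)

lemma baseChangeMap_tmul {X Y : ModuleCat.{u} S} (φ : X ⟶ Y) (a : A) (x : X) :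
    baseChangeMap e φ (toBaseChange e X (a ⊗ₜ x)) = toBaseChange e Y (a ⊗ₜ φ x) :=
  (baseChangeLift_tmul e _ a x).trans (smul_baseChangeUnit e Y a (φ x))

lemma baseChangeMap_apply {X Y : ModuleCat.{u} S} (φ : X ⟶ Y) (y : A ⊗[R] X) :
    baseChangeMap e φ (toBaseChange e X y) =
      toBaseChange e Y ((φ.hom.restrictScalars R).lTensor A y) := by
  induction y using TensorProduct.induction_on with
  | zero => simp
  | tmul a x => exact baseChangeMap_tmul e φ a x
  | add y z hy hz => simp only [map_add, hy, hz]

/-- Base change from `S`-modules to `S'`-modules. -/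
def baseChangeFunctor : ModuleCat.{u} S ⥤ ModuleCat.{u} S' where
  obj X := baseChangeObj e X
  map φ := baseChangeMap e φ
  map_id X := baseChange_hom_ext e fun x => baseChangeMap_tmul e (𝟙 X) 1 x
  map_comp φ ψ := baseChange_hom_ext e fun x => by
    rw [ConcreteCategory.comp_apply, baseChangeMap_tmul, baseChangeMap_tmul, baseChangeMap_tmul]
    rfl

/-- Base change is left adjoint to restriction of scalars. -/
def baseChangeHomEquiv (X : ModuleCat.{u} S) (Y : ModuleCat.{u} S') :
    (baseChangeObj e X ⟶ Y) ≃
      (X ⟶ (ModuleCat.restrictScalars (baseChangeRingHom e)).obj Y) where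
  toFun φ := baseChangeUnit e X ≫ (ModuleCat.restrictScalars _).map φ
  invFun g := baseChangeLift e g
  left_inv φ := baseChange_hom_ext e fun x => baseChangeLift_one_tmul e _ x
  right_inv g := by
    ext x
    exact baseChangeLift_one_tmul e g x

lemma baseChangeLift_precomp {X X' : ModuleCat.{u} S} {Y : ModuleCat.{u} S'} (φ : X' ⟶ X)
    (g : X ⟶ (ModuleCat.restrictScalars (baseChangeRingHom e)).obj Y) :
    baseChangeLift e (φ ≫ g) = baseChangeMap e φ ≫ baseChangeLift e g :=
  baseChange_hom_ext e fun x => by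
    rw [ConcreteCategory.comp_apply, baseChangeMap_tmul, baseChangeLift_one_tmul,
      baseChangeLift_one_tmul]
    rfl

/-- Base change is left adjoint to restriction of scalars. -/
def baseChangeAdj :
    baseChangeFunctor e ⊣ ModuleCat.restrictScalars (baseChangeRingHom e) :=
  Adjunction.mkOfHomEquiv
    { homEquiv := baseChangeHomEquiv e
      homEquiv_naturality_left_symm := fun φ g => baseChangeLift_precomp e φ g
      homEquiv_naturality_right := fun _ _ => rfl }

lemma baseChangeMap_add {X Y : ModuleCat.{u} S} (φ ψ : X ⟶ Y) :
    baseChangeMap e (φ + ψ) = baseChangeMap e φ + baseChangeMap e ψ :=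
  baseChange_hom_ext e fun x => by
    rw [baseChangeMap_tmul]
    change _ = baseChangeMap e φ _ + baseChangeMap e ψ _
    rw [baseChangeMap_tmul, baseChangeMap_tmul, ← map_add, ← tmul_add]
    rfl

instance : (baseChangeFunctor e).Additive where
  map_add := baseChangeMap_add e _ _

/-- Exactness is visible on underlying groups, where base change is `A ⊗[R] -`, exact by flatness.
-/
instance [Module.Flat R A] : (baseChangeFunctor e).PreservesHomology := by
  refine ((Functor.exact_tfae (baseChangeFunctor e)).out 1 2).1 fun T hT => ?_
  rw [ShortComplex.ShortExact.moduleCat_exact_iff_function_exact] at hT ⊢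
  have hT' := Module.Flat.lTensor_exact (R := R) A (f := T.f.hom.restrictScalars R)
    (g := T.g.hom.restrictScalars R) hT
  intro y
  obtain ⟨y, rfl⟩ := (toBaseChange e T.X₂).surjective y
  refine Iff.trans (b := (T.g.hom.restrictScalars R).lTensor A y = 0) ?_ ((hT' y).trans ?_)
  · rw [← (toBaseChange e T.X₃).map_eq_zero_iff, ← baseChangeMap_apply]
    rfl
  · constructor
    · rintro ⟨z, rfl⟩
      exact ⟨toBaseChange e T.X₁ z, baseChangeMap_apply e T.f z⟩
    · rintro ⟨z, hz⟩
      obtain ⟨z, rfl⟩ := (toBaseChange e T.X₁).surjective z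
      exact ⟨z, (toBaseChange e T.X₂).injective ((baseChangeMap_apply e T.f z).symm.trans hz)⟩

lemma projective_baseChange (X : ModuleCat.{u} S) [Projective X] :
    Projective ((baseChangeFunctor e).obj X) :=
  (baseChangeAdj e).map_projective X inferInstance

end BaseChange

/-! ### Transposing cochains along an adjunction -/

section Adjunction

variable {C D : Type*} [Category* C] [Category* D] [Preadditive C] [Preadditive D]
  {F : C ⥤ D} {G : D ⥤ C} [F.Additive] [G.Additive] (adj : F ⊣ G)

/-- The unit of an adjunction, on complexes. -/
abbrev unitComplex (P : CochainComplex C ℤ) :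
    P ⟶ (G.mapHomologicalComplex _).obj ((F.mapHomologicalComplex _).obj P) where
  f i := adj.unit.app (P.X i)
  comm' i j _ := (adj.unit.naturality (P.d i j)).symm

variable {P : CochainComplex C ℤ} {N : CochainComplex D ℤ}

/-- The transposition of cochains along an adjunction. -/
def transposeCochain {n : ℤ} (z : Cochain ((F.mapHomologicalComplex _).obj P) N n) :
    Cochain P ((G.mapHomologicalComplex _).obj N) n :=
  (Cochain.ofHom (unitComplex adj P)).comp (z.map G) (zero_add n)

lemma transposeCochain_v {n : ℤ} (z : Cochain ((F.mapHomologicalComplex _).obj P) N n)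
    (p q : ℤ) (hpq : p + n = q) :
    (transposeCochain adj z).v p q hpq = adj.homEquiv _ _ (z.v p q hpq) := by
  rw [transposeCochain, Cochain.zero_cochain_comp_v, Cochain.ofHom_v, Cochain.map_v]
  exact (adj.homEquiv_unit _ _ _).symm

lemma transposeCochain_bijective (n : ℤ) : Function.Bijective
    (transposeCochain adj : Cochain ((F.mapHomologicalComplex _).obj P) N n → _) := by
  constructor
  · intro z z' h
    ext1 p q hpq
    apply (adj.homEquiv _ _).injective
    rw [← transposeCochain_v, ← transposeCochain_v, h]
  · intro y
    refine ⟨Cochain.mk fun p q hpq => (adj.homEquiv _ _).symm (y.v p q hpq), ?_⟩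
    ext1 p q hpq
    rw [transposeCochain_v]
    exact (adj.homEquiv _ _).apply_symm_apply _

lemma δ_transposeCochain (n m : ℤ) (z : Cochain ((F.mapHomologicalComplex _).obj P) N n) :
    δ n m (transposeCochain adj z) = transposeCochain adj (δ n m z) := by
  rw [transposeCochain, δ_ofHom_comp, δ_map, transposeCochain]

lemma transposeCochain_ofHom (u : (F.mapHomologicalComplex _).obj P ⟶ N) :
    transposeCochain adj (Cochain.ofHom u) =
      Cochain.ofHom (unitComplex adj P ≫ (G.mapHomologicalComplex _).map u) := by
  rw [transposeCochain, Cochain.map_ofHom, ← Cochain.ofHom_comp]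

lemma transposeCochain_add {n : ℤ} (z z' : Cochain ((F.mapHomologicalComplex _).obj P) N n) :
    transposeCochain adj (z + z') = transposeCochain adj z + transposeCochain adj z' := by
  simp [transposeCochain]

/-- Transposition is bijective on cochains and commutes with `δ`, so it is an isomorphism of Hom
complexes. -/
lemma RepresentsHom.transpose {T : Type*} [Zero T]
    {β : T → ((F.mapHomologicalComplex _).obj P ⟶ N)} (hβ : RepresentsHom β) :
    RepresentsHom fun t => unitComplex adj P ≫ (G.mapHomologicalComplex _).map (β t) := by
  refine ⟨fun n hn z hz => ?_, fun u => ?_, fun t ⟨w, hw⟩ => hβ.inj t ?_⟩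
  · obtain ⟨z, rfl⟩ := (transposeCochain_bijective adj n).2 z
    rw [δ_transposeCochain] at hz
    obtain ⟨w, hw⟩ := hβ.exact n hn z ((transposeCochain_bijective adj (n + 1)).1
      (hz.trans (by simp [transposeCochain])))
    exact ⟨transposeCochain adj w, by rw [δ_transposeCochain, hw]⟩
  · obtain ⟨z, hz⟩ := (transposeCochain_bijective adj 0).2 (Cochain.ofHom u)
    -- A zero-cochain comes from a morphism of complexes exactly when it is a cocycle, and
    -- transposition reflects this.
    have hz' : δ 0 1 z = 0 := (transposeCochain_bijective adj 1).1 (by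
      rw [← δ_transposeCochain, hz, δ_ofHom]
      simp [transposeCochain])
    obtain ⟨v, hv⟩ := (Cocycle.equivHom _ _).surjective (Cocycle.mk z 1 (by simp) hz')
    have hv' : Cochain.ofHom v = z := congrArg Subtype.val hv
    obtain ⟨t, w, hw⟩ := hβ.surj v
    refine ⟨t, transposeCochain adj w, ?_⟩
    rw [← hz, ← hv', hw, transposeCochain_add, δ_transposeCochain, transposeCochain_ofHom]
  · obtain ⟨w, rfl⟩ := (transposeCochain_bijective adj (-1)).2 w
    rw [δ_transposeCochain, ← transposeCochain_ofHom] at hw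
    exact ⟨w, (transposeCochain_bijective adj 0).1 hw⟩

end Adjunction

attribute [local instance] algBase algBase_tower linearModuleCat

/-! ### Localizing a resolution -/

section Localization

variable {R A S S' : Type u} [CommRing R] [CommRing A] [Algebra R A] [Ring S] [Algebra R S]
  [Ring S'] (e : S' ≃+* A ⊗[R] S) (W : Submonoid R) [IsLocalization W A]

lemma isIso_baseChangeLift {X : ModuleCat.{u} S} {Y : ModuleCat.{u} S'}
    (l : X ⟶ (ModuleCat.restrictScalars (baseChangeRingHom e)).obj Y)
    (hl : IsLocalizedModule W (l.hom.restrictScalars R)) : IsIso (baseChangeLift e l) := by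
  let Z := (ModuleCat.restrictScalars (baseChangeRingHom e)).obj Y
  let L : A ⊗[R] X →ₗ[R] Z :=
    { toFun := fun y => baseChangeLiftAux e l y
      map_add' := fun y z => map_add _ _ _
      map_smul' := fun r y => by
        induction y using TensorProduct.induction_on with
        | zero =>
          rw [smul_zero, map_zero]
          exact (smul_zero (A := Z) r).symm
        | add y z hy hz =>
          simp only [RingHom.id_apply] at hy hz ⊢
          rw [smul_add, map_add, map_add, hy, hz]
          exact (smul_add r (show Z from _) (show Z from _)).symm
        | tmul a x =>
          change baseChangeLiftAux e l _ =
            e.symm (1 ⊗ₜ algebraMap R S r) • baseChangeLiftAux e l (a ⊗ₜ x)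
          rw [smul_tmul', baseChangeLiftAux_tmul, baseChangeLiftAux_tmul, smul_smul, ← map_mul,
            Algebra.TensorProduct.tmul_mul_tmul, one_mul, mul_one,
            Algebra.algebraMap_eq_smul_one, tmul_smul, smul_tmul'] }
  have hloc : IsLocalizedModule W (TensorProduct.mk R A X 1) :=
    (isLocalizedModule_iff_isBaseChange W A _).2 (TensorProduct.isBaseChange R X A)
  -- Both maps extend `l`, and a map out of a localization is determined by its restriction to `X`.
  have hL : L = (IsLocalizedModule.linearEquiv W (TensorProduct.mk R A X 1)
      (l.hom.restrictScalars R)).toLinearMap := by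
    refine IsLocalizedModule.ext W (TensorProduct.mk R A X 1)
      (fun x => IsLocalizedModule.map_units (l.hom.restrictScalars R) x) ?_
    ext x
    refine (baseChangeLift_one_tmul e l x).trans ?_
    exact (IsLocalizedModule.linearEquiv_apply W (TensorProduct.mk R A X 1)
      (l.hom.restrictScalars R) x).symm
  have hb : Function.Bijective L := by
    rw [hL]
    exact LinearEquiv.bijective _
  rw [ConcreteCategory.isIso_iff_bijective]
  exact hb

variable {N P : CochainComplex (ModuleCat.{u} S) ℤ} {N' : CochainComplex (ModuleCat.{u} S') ℤ}

lemma baseChangeLift_comm {X X' : ModuleCat.{u} S} {Y Y' : ModuleCat.{u} S'}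
    (l : X ⟶ (ModuleCat.restrictScalars (baseChangeRingHom e)).obj Y)
    (l' : X' ⟶ (ModuleCat.restrictScalars (baseChangeRingHom e)).obj Y')
    (d : X ⟶ X') (d' : Y ⟶ Y')
    (hd : l ≫ (ModuleCat.restrictScalars (baseChangeRingHom e)).map d' = d ≫ l') :
    baseChangeLift e l ≫ d' = baseChangeMap e d ≫ baseChangeLift e l' := by
  rw [← baseChangeLift_precomp, ← hd]
  refine baseChange_hom_ext e fun x => ?_
  rw [ConcreteCategory.comp_apply, baseChangeLift_one_tmul, baseChangeLift_one_tmul]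
  rfl

/-- The extension of scalars of a morphism of complexes. -/
def baseChangeLiftComplex
    (l : N ⟶ ((ModuleCat.restrictScalars (baseChangeRingHom e)).mapHomologicalComplex _).obj N') :
    ((baseChangeFunctor e).mapHomologicalComplex _).obj N ⟶ N' where
  f i := baseChangeLift e (l.f i)
  comm' i j _ := baseChangeLift_comm e _ _ _ _ (l.comm i j)

lemma unitComplex_baseChange_comp
    (p : P ⟶ ((ModuleCat.restrictScalars (baseChangeRingHom e)).mapHomologicalComplex _).obj N') :
    unitComplex (baseChangeAdj e) P ≫
      ((ModuleCat.restrictScalars (baseChangeRingHom e)).mapHomologicalComplex _).map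
        (baseChangeLiftComplex e p) = p := by
  ext i x
  exact baseChangeLift_one_tmul e (p.f i) x

lemma map_comp_baseChangeLiftComplex (p : P ⟶ N)
    (l : N ⟶ ((ModuleCat.restrictScalars (baseChangeRingHom e)).mapHomologicalComplex _).obj N') :
    ((baseChangeFunctor e).mapHomologicalComplex _).map p ≫ baseChangeLiftComplex e l =
      baseChangeLiftComplex e (p ≫ l) := by
  ext1 i
  exact (baseChangeLift_precomp e (p.f i) (l.f i)).symm

/-- The map factors as the base change of `p`, a quasi-isomorphism by flatness, followed by the
isomorphism from the base change of `N` to `N'`. -/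
lemma quasiIso_baseChangeLiftComplex (p : P ⟶ N) [QuasiIso p]
    (l : N ⟶ ((ModuleCat.restrictScalars (baseChangeRingHom e)).mapHomologicalComplex _).obj N')
    (hl : ∀ i, IsLocalizedModule W ((l.f i).hom.restrictScalars R)) :
    QuasiIso (baseChangeLiftComplex e (p ≫ l)) := by
  have : Module.Flat R A := IsLocalization.flat A W
  have : ∀ i, IsIso ((baseChangeLiftComplex e l).f i) := fun i =>
    isIso_baseChangeLift e W (l.f i) (hl i)
  have : IsIso (baseChangeLiftComplex e l) := HomologicalComplex.Hom.isIso_of_components _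
  rw [← map_comp_baseChangeLiftComplex]
  infer_instance

lemma isKProjective_of_bounded {S : Type u} [Ring S] (P : CochainComplex (ModuleCat.{u} S) ℤ)
    (hP : ∃ a b : ℤ, ∀ i, i < a ∨ b < i → Limits.IsZero (P.X i))
    (hproj : ∀ i, Projective (P.X i)) : P.IsKProjective := by
  obtain ⟨a, b, hab⟩ := hP
  have : P.IsStrictlyLE b := by
    rw [CochainComplex.isStrictlyLE_iff]
    exact fun i hi => hab i (Or.inr hi)
  exact CochainComplex.isKProjective_of_projective P b

/-- The derived endomorphisms of a localization, computed by a resolution before localizing. -/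
theorem MulIsIso.representsHom_of_isLocalizedModule {E' T' : Type u} [Ring E'] [Ring T']
    {f' : S' →+* E'} {g' : T' →+* E'} {h' : ∀ s t, Commute (f' s) (g' t)}
    {M' : CochainComplex (ModuleCat.{u} E') ℤ} (hM' : MulIsIso f' g' h' M')
    (hP : ∃ a b : ℤ, ∀ i, i < a ∨ b < i → Limits.IsZero (P.X i))
    (hproj : ∀ i, Projective (P.X i)) (p : P ⟶ N) [QuasiIso p]
    (l : N ⟶ ((ModuleCat.restrictScalars (baseChangeRingHom e)).mapHomologicalComplex _).obj
      (((ModuleCat.restrictScalars f').mapHomologicalComplex _).obj M'))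
    (hl : ∀ i, IsLocalizedModule W ((l.f i).hom.restrictScalars R)) :
    RepresentsHom fun t => p ≫ l ≫
      ((ModuleCat.restrictScalars (baseChangeRingHom e)).mapHomologicalComplex _).map
        (actComplex f' g' h' t M') := by
  obtain ⟨P₁, p₁, hP₁, hp₁, hq⟩ := hM'
  rw [quasiIso_mulMap_iff] at hq
  have := quasiIso_baseChangeLiftComplex e W p l hl
  have : CochainComplex.IsKProjective
      (((baseChangeFunctor e).mapHomologicalComplex (ComplexShape.up ℤ)).obj P) := by
    refine isKProjective_of_bounded _ ?_ fun i => projective_baseChange e (P.X i)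
    obtain ⟨a, b, hab⟩ := hP
    exact ⟨a, b, fun i hi => (baseChangeFunctor e).map_isZero (hab i hi)⟩
  -- The given resolution `p₁` is exchanged for the localization of `P`, and the result is
  -- transposed to cochains on `P` itself.
  have h := (RepresentsHom.of_quasiIso _ p₁ (baseChangeLiftComplex e (p ≫ l)) hq).transpose
    (baseChangeAdj e)
  simp only [Functor.map_comp] at h
  simpa only [← Category.assoc, unitComplex_baseChange_comp] using h

end Localization

/-! ### Localization maps between bimodules -/

section LocalizationMap

variable {R S E S' E' : Type u} [CommRing R] [Ring S] [Algebra R S] [Ring E] [Ring S'] [Ring E']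

/-- A semilinear map between modules over larger rings, as a map of restricted modules. -/
def restrictScalarsHom (f : S →+* E) (φ : S →+* S') (f' : S' →+* E') {M : ModuleCat.{u} E}
    {M' : ModuleCat.{u} E'} (k : M →+ M') (hk : ∀ s x, k (f s • x) = f' (φ s) • k x) :
    (ModuleCat.restrictScalars f).obj M ⟶
      (ModuleCat.restrictScalars φ).obj ((ModuleCat.restrictScalars f').obj M') :=
  ModuleCat.ofHom (X := (ModuleCat.restrictScalars f).obj M)
    (Y := (ModuleCat.restrictScalars φ).obj ((ModuleCat.restrictScalars f').obj M'))
    { toFun := fun x => k x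
      map_add' := fun x y => k.map_add x y
      map_smul' := fun s x => hk s x }

/-- The map `k` is semilinear over `φ : S → S'` and a localization of `R`-modules with respect
to `W`. -/
structure IsLocalizationMap (W : Submonoid R) (f : S →+* E) (φ : S →+* S') (f' : S' →+* E')
    {M : ModuleCat.{u} E} {M' : ModuleCat.{u} E'} (k : M →+ M') : Prop where
  map_smul : ∀ s x, k (f s • x) = f' (φ s) • k x
  bijective : ∀ w ∈ W, Function.Bijective fun y : M' => f' (φ (algebraMap R S w)) • y
  surj : ∀ y, ∃ x, ∃ w ∈ W, f' (φ (algebraMap R S w)) • y = k x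
  eq_zero : ∀ x, k x = 0 → ∃ w ∈ W, f (algebraMap R S w) • x = 0

variable {W : Submonoid R} {f : S →+* E} {φ : S →+* S'} {f' : S' →+* E'}
    {M : ModuleCat.{u} E} {M' : ModuleCat.{u} E'} {k : M →+ M'}

lemma IsLocalizationMap.isLocalizedModule (hk : IsLocalizationMap W f φ f' k) :
    IsLocalizedModule W
      ((restrictScalarsHom f φ f' k hk.map_smul).hom.restrictScalars R) where
  map_units w := (Module.End.isUnit_iff _).2 (hk.bijective w w.2)
  surj y := by
    obtain ⟨x, w, hw, h⟩ := hk.surj y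
    exact ⟨(x, ⟨w, hw⟩), h⟩
  exists_of_eq {x y} h := by
    obtain ⟨w, hw, h'⟩ := hk.eq_zero ((show M from x) - (show M from y))
      ((k.map_sub _ _).trans (sub_eq_zero.2 h))
    rw [smul_sub, sub_eq_zero] at h'
    exact ⟨⟨w, hw⟩, h'⟩

/-- The `S'`-linear extension of `k` is invertible. This carries bounds on projective dimension from
`M'` to the base change of `M`. -/
lemma IsLocalizationMap.nonempty_iso {A : Type u} [CommRing A] [Algebra R A] [IsLocalization W A]
    {e : S' ≃+* A ⊗[R] S} (hk : IsLocalizationMap W f (baseChangeRingHom e) f' k) :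
    Nonempty ((baseChangeFunctor e).obj ((ModuleCat.restrictScalars f).obj M) ≅
      (ModuleCat.restrictScalars f').obj M') := by
  have h := isIso_baseChangeLift e W _ hk.isLocalizedModule
  exact ⟨@asIso _ _ _ _ _ h⟩

end LocalizationMap

/-! ### The multiplication map is an isomorphism if it is so locally -/

section Global

variable {R S T E : Type u} [CommRing R] [Ring S] [Algebra R S] [Ring T] [Algebra R T] [Ring E]

/-- The multiplication map of `M` is an isomorphism after localization at `m`. -/
def MulIsIsoAt (m : Ideal R) [m.IsPrime] (f : S →+* E) (g : T →+* E)
    (M : CochainComplex (ModuleCat.{u} E) ℤ) : Prop :=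
  ∃ (S' T' E' : Type u) (_ : Ring S') (_ : Ring T') (_ : Ring E') (_ : Algebra R T')
    (f' : S' →+* E') (g' : T' →+* E') (h' : ∀ s t, Commute (f' s) (g' t))
    (M' : CochainComplex (ModuleCat.{u} E') ℤ) (e : S' ≃+* Localization.AtPrime m ⊗[R] S)
    (k : ∀ i, M.X i →+ M'.X i) (τ : T →ₗ[R] T'),
    MulIsIso f' g' h' M' ∧
    (∀ r, f' (baseChangeRingHom e (algebraMap R S r)) = g' (algebraMap R T' r)) ∧
    (∀ i, IsLocalizationMap m.primeCompl f (baseChangeRingHom e) f' (k i)) ∧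
    (∀ i j x, k j (M.d i j x) = M'.d i j (k i x)) ∧
    IsLocalizedModule m.primeCompl τ ∧ (∀ i t x, k i (g t • x) = g' (τ t) • k i x)

lemma MulIsIso.mulIsIsoAt {m : Ideal R} [m.IsPrime] {f : S →+* E} {g : T →+* E}
    {M : CochainComplex (ModuleCat.{u} E) ℤ} {S' T' E' : Type u} [Ring S'] [Ring T'] [Ring E']
    {f' : S' →+* E'} {g' : T' →+* E'} {h' : ∀ s t, Commute (f' s) (g' t)}
    {M' : CochainComplex (ModuleCat.{u} E') ℤ} (hM' : MulIsIso f' g' h' M') [Algebra R T']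
    (e : S' ≃+* Localization.AtPrime m ⊗[R] S) (k : ∀ i, M.X i →+ M'.X i) (τ : T →ₗ[R] T')
    (hfg : ∀ r, f' (baseChangeRingHom e (algebraMap R S r)) = g' (algebraMap R T' r))
    (hk : ∀ i, IsLocalizationMap m.primeCompl f (baseChangeRingHom e) f' (k i))
    (hd : ∀ i j x, k j (M.d i j x) = M'.d i j (k i x))
    (hτ : IsLocalizedModule m.primeCompl τ) (hkτ : ∀ i t x, k i (g t • x) = g' (τ t) • k i x) :
    MulIsIsoAt m f g M :=
  ⟨S', T', E', _, _, _, _, f', g', h', M', e, k, τ, hM', hfg, hk, hd, hτ, hkτ⟩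

/-- The multiplication map is an isomorphism if it is so locally. -/
theorem mulIsIso_of_forall_maximal [IsNoetherianRing R] [Module.Finite R S]
    (f : S →+* E) (g : T →+* E)
    (h : ∀ s t, Commute (f s) (g t)) (hfg : ∀ r, f (algebraMap R S r) = g (algebraMap R T r))
    (M : CochainComplex (ModuleCat.{u} E) ℤ)
    (hM : IsPerfect (((ModuleCat.restrictScalars f).mapHomologicalComplex _).obj M))
    (H : ∀ (m : Ideal R) [m.IsMaximal], MulIsIsoAt m f g M) : MulIsIso f g h M := by
  obtain ⟨P, p, hP, hfp, hp⟩ := hM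
  have hproj : ∀ i, Projective (P.X i) := fun i => by
    have := (hfp i).2
    infer_instance
  refine ⟨P, p, isKProjective_of_bounded P hP hproj, hp, ?_⟩
  rw [quasiIso_mulMap_iff]
  let β : T →ₗ[R] (P ⟶ ((ModuleCat.restrictScalars f).mapHomologicalComplex _).obj M) :=
    { toFun := fun t => p ≫ actComplex f g h t M
      map_add' := fun t t' => by
        ext i x
        change g (t + t') • (show M.X i from p.f i x) =
          g t • (show M.X i from p.f i x) + g t' • (show M.X i from p.f i x)
        rw [map_add, add_smul]
      -- Centrality of `R` enters here: its actions through `S` and through `T` agree.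
      map_smul' := fun r t => by
        ext i x
        change g (r • t) • (show M.X i from p.f i x) =
          f (algebraMap R S r) • g t • (show M.X i from p.f i x)
        rw [hfg, smul_smul, ← map_mul, Algebra.smul_def] }
  refine RepresentsHom.of_localization hP (fun i => (hfp i).1) β fun m _ => ?_
  obtain ⟨S', T', E', _, _, _, _, f', g', h', M', e, k, τ, hM', hfg', hk, hd, hτ, hkτ⟩ := H m
  let l : ((ModuleCat.restrictScalars f).mapHomologicalComplex _).obj M ⟶
      ((ModuleCat.restrictScalars (baseChangeRingHom e)).mapHomologicalComplex _).obj
        (((ModuleCat.restrictScalars f').mapHomologicalComplex _).obj M') :=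
    { f := fun i => restrictScalarsHom f (baseChangeRingHom e) f' (k i) (hk i).map_smul
      comm' := fun i j _ => by
        ext x
        exact (hd i j x).symm }
  have hl : ∀ i, IsLocalizedModule m.primeCompl ((l.f i).hom.restrictScalars R) :=
    fun i => (hk i).isLocalizedModule
  let β' : T' →ₗ[R] (P ⟶
      ((ModuleCat.restrictScalars (baseChangeRingHom e)).mapHomologicalComplex _).obj
          (((ModuleCat.restrictScalars f').mapHomologicalComplex _).obj M')) :=
    { toFun := fun t => p ≫ l ≫
        ((ModuleCat.restrictScalars (baseChangeRingHom e)).mapHomologicalComplex _).map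
          (actComplex f' g' h' t M')
      map_add' := fun t t' => by
        ext i x
        change g' (t + t') • (show M'.X i from l.f i (p.f i x)) =
          g' t • (show M'.X i from l.f i (p.f i x)) + g' t' • (show M'.X i from l.f i (p.f i x))
        rw [map_add, add_smul]
      map_smul' := fun r t => by
        ext i x
        change g' (r • t) • (show M'.X i from l.f i (p.f i x)) =
          f' (baseChangeRingHom e (algebraMap R S r)) • g' t •
            (show M'.X i from l.f i (p.f i x))
        rw [hfg', smul_smul, ← map_mul, Algebra.smul_def] }
  refine ⟨_, l, T', _, _, τ, β', hl, hτ, fun t => ?_,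
    hM'.representsHom_of_isLocalizedModule e m.primeCompl hP hproj p l hl⟩
  ext i x
  exact hkτ i t (p.f i x)

end Global

section Transport

variable {E S T : Type u} [Ring E] [Ring S] [Ring T]
  {f : S →+* E} {g : T →+* E} {h : ∀ s t, Commute (f s) (g t)}

/-- Needed because localizing and placing in degree zero commute only up to isomorphism. -/
lemma MulIsIso.of_iso {M M' : CochainComplex (ModuleCat.{u} E) ℤ} (hM : MulIsIso f g h M)
    (e : M ≅ M') : MulIsIso f g h M' := by
  obtain ⟨P, p, hP, hp, hq⟩ := hM
  rw [quasiIso_mulMap_iff] at hq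
  let e' := ((ModuleCat.restrictScalars f).mapHomologicalComplex (ComplexShape.up ℤ)).mapIso e
  refine ⟨P, p ≫ e'.hom, hP, inferInstance, ?_⟩
  rw [quasiIso_mulMap_iff]
  convert! hq.postcomp_iso e' using 2 with t
  ext i x
  exact ((e.hom.f i).hom.map_smul (g t) (show M.X i from p.f i x)).symm

end Transport

/-! ### Localized bimodules as localizations on either side -/

section OpBaseChange

variable (R A Γ : Type u) [CommRing R] [CommRing A] [Algebra R A] [Ring Γ] [Algebra R Γ]

/-- `(A ⊗ Γ)ᵐᵒᵖ ≃ A ⊗ Γᵐᵒᵖ` -/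
def opBaseChangeEquiv : (A ⊗[R] Γ)ᵐᵒᵖ ≃+* A ⊗[R] Γᵐᵒᵖ :=
  ((Algebra.TensorProduct.congr (AlgEquiv.toOpposite R A) AlgEquiv.refl).trans
    (Algebra.TensorProduct.opAlgEquiv R R A Γ)).symm.toRingEquiv

end OpBaseChange

section LocMap

variable {R Γ : Type u} [CommRing R] [Ring Γ] [Algebra R Γ] (m : Ideal R) [m.IsPrime]
  {S S' : Type u} [Ring S] [Algebra R S] [Ring S'] (e : S' ≃+* Localization.AtPrime m ⊗[R] S)

/-- The ring homomorphisms `f : S → Γ ⊗ Γᵐᵒᵖ` and `f' : S' → Γ_m ⊗ Γ_mᵐᵒᵖ` with `S' = S_m`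
define compatible actions on bimodules and on their localizations. -/
structure LocCompatible (f : S →+* Env R Γ)
    (f' : S' →+* Env (Localization.AtPrime m) (LocAlg m Γ)) : Prop where
  map_algebraMap : ∀ r, f (algebraMap R S r) = algebraMap R (Env R Γ) r
  act : ∀ (M : ModuleCat.{u} (Env R Γ)) (s : S) (t : Localization.AtPrime m) (x : M),
    locAct m Γ M (f' (baseChangeRingHom e s)) (t ⊗ₜ x) = t ⊗ₜ (f s • x)

lemma locCompatible_left : LocCompatible m (RingEquiv.refl (LocAlg m Γ)) (inl R Γ)
    (inl (Localization.AtPrime m) (LocAlg m Γ)) where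
  map_algebraMap r := (Algebra.TensorProduct.includeLeft : Γ →ₐ[R] Γ ⊗[R] Γᵐᵒᵖ).commutes r
  act M s t x := by
    refine (locAct_tmul m Γ M 1 1 t s 1 x).trans ?_
    rw [one_mul, one_mul, op_one, map_one, one_smul]

/-- Right modules are modules over `(LocAlg m Γ)ᵐᵒᵖ`, which is only isomorphic to a base change of
`Γᵐᵒᵖ`; hence the ring `S'` with an equivalence `e` throughout. -/
lemma locCompatible_right : LocCompatible m (opBaseChangeEquiv R (Localization.AtPrime m) Γ)
    (inr R Γ) (inr (Localization.AtPrime m) (LocAlg m Γ)) where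
  map_algebraMap r := (Algebra.TensorProduct.includeRight : Γᵐᵒᵖ →ₐ[R] Γ ⊗[R] Γᵐᵒᵖ).commutes r
  act M s t x := by
    refine (locAct_tmul m Γ M 1 1 t 1 (unop s) x).trans ?_
    rw [one_mul, one_mul, map_one, one_smul, op_unop]

variable {m e} {f : S →+* Env R Γ} {f' : S' →+* Env (Localization.AtPrime m) (LocAlg m Γ)}

variable (m) in
/-- The elements of `R_m ⊗ M` in the localized bimodule. -/
def toLoc (M : ModuleCat.{u} (Env R Γ)) : LocMod m Γ M ≃+ locObj m Γ M := AddEquiv.refl _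

lemma smul_toLoc (M : ModuleCat.{u} (Env R Γ))
    (s : Env (Localization.AtPrime m) (LocAlg m Γ)) (y : LocMod m Γ M) :
    s • toLoc m M y = toLoc m M (locAct m Γ M s y) := rfl

lemma LocCompatible.smul_toLoc (hf : LocCompatible m e f f')
    (M : ModuleCat.{u} (Env R Γ)) (s : S)
    (t : Localization.AtPrime m) (x : M) :
    f' (baseChangeRingHom e s) • toLoc m M (t ⊗ₜ x) = toLoc m M (t ⊗ₜ (f s • x)) := by
  rw [TiltingBimod.smul_toLoc, hf.act]

variable (m) in
/-- The localization map `x ↦ 1 ⊗ x`. -/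
def locMap (M : ModuleCat.{u} (Env R Γ)) : M →+ locObj m Γ M :=
  (toLoc m M).toAddMonoidHom.comp
    (TensorProduct.mk R (Localization.AtPrime m) M 1).toAddMonoidHom

lemma locMap_apply (M : ModuleCat.{u} (Env R Γ)) (x : M) : locMap m M x = toLoc m M (1 ⊗ₜ x) := rfl

lemma LocCompatible.algebraMap_smul (hf : LocCompatible m e f f')
    (M : ModuleCat.{u} (Env R Γ)) (r : R) (y : LocMod m Γ M) :
    f' (baseChangeRingHom e (algebraMap R S r)) • toLoc m M y = toLoc m M (r • y) := by
  rw [TiltingBimod.smul_toLoc]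
  congr 1
  induction y using TensorProduct.induction_on with
  | zero => simp
  | add x y hx hy => rw [smul_add, map_add, hx, hy]
  | tmul t x =>
    rw [hf.act, hf.map_algebraMap, ← tmul_smul]
    rfl

lemma LocCompatible.isLocalizationMap (hf : LocCompatible m e f f')
    (M : ModuleCat.{u} (Env R Γ)) :
    IsLocalizationMap m.primeCompl f (baseChangeRingHom e) f' (locMap m M) := by
  have hloc : IsLocalizedModule m.primeCompl (TensorProduct.mk R (Localization.AtPrime m) M 1) :=
    (isLocalizedModule_iff_isBaseChange m.primeCompl (Localization.AtPrime m) _).2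
      (TensorProduct.isBaseChange R M _)
  refine ⟨fun s x => (hf.smul_toLoc M s 1 x).symm, fun w hw => ?_, fun y => ?_, fun x hx => ?_⟩
  · have h := (Module.End.isUnit_iff _).1 (hloc.map_units ⟨w, hw⟩)
    have h' : (fun y : locObj m Γ M =>
        f' (baseChangeRingHom e (algebraMap R S w)) • y) =
        toLoc m M ∘ (fun y => w • y) ∘ (toLoc m M).symm := by
      ext y
      obtain ⟨y, rfl⟩ := (toLoc m M).surjective y
      rw [hf.algebraMap_smul]
      simp
    rw [h']
    exact (toLoc m M).bijective.comp (h.comp (toLoc m M).symm.bijective)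
  · obtain ⟨y, rfl⟩ := (toLoc m M).surjective y
    obtain ⟨⟨x, w⟩, h⟩ := hloc.surj y
    exact ⟨x, w, w.2, (hf.algebraMap_smul M w y).trans (congrArg (toLoc m M) h)⟩
  · rw [locMap_apply, EmbeddingLike.map_eq_zero_iff] at hx
    obtain ⟨w, hw⟩ := hloc.exists_of_eq (x₁ := x) (x₂ := 0) (hx.trans (map_zero _).symm)
    rw [smul_zero] at hw
    refine ⟨w, w.2, ?_⟩
    rw [hf.map_algebraMap]
    exact hw

lemma locMap_naturality {M N : ModuleCat.{u} (Env R Γ)} (φ : M ⟶ N) (x : M) :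
    locMap m N (φ x) = (locFunctor m Γ).map φ (locMap m M x) := rfl

end LocMap

/-! ### Tilting is local for biperfect complexes -/

section Tilting

variable {R Γ : Type u} [CommRing R] [Ring Γ] [Algebra R Γ]

lemma inl_algebraMap_eq_inr_algebraMap (r : R) :
    inl R Γ (algebraMap R Γ r) = inr R Γ (algebraMap R Γᵐᵒᵖ r) :=
  ((Algebra.TensorProduct.includeLeft : Γ →ₐ[R] Γ ⊗[R] Γᵐᵒᵖ).commutes r).trans
    ((Algebra.TensorProduct.includeRight : Γᵐᵒᵖ →ₐ[R] Γ ⊗[R] Γᵐᵒᵖ).commutes r).symm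

section OneTmul

variable (A : Type u) [CommRing A] [Algebra R A]

lemma one_tmul_algebraMap (r : R) :
    (1 : A) ⊗ₜ[R] algebraMap R Γ r = algebraMap A (A ⊗[R] Γ) (algebraMap R A r) := by
  rw [Algebra.TensorProduct.algebraMap_apply, Algebra.algebraMap_self_apply,
    Algebra.algebraMap_eq_smul_one, Algebra.algebraMap_eq_smul_one, tmul_smul, smul_tmul']

lemma algebraMap_baseChange (r : R) :
    algebraMap R (A ⊗[R] Γ) r = algebraMap A (A ⊗[R] Γ) (algebraMap R A r) := by
  rw [← one_tmul_algebraMap]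
  exact (Algebra.TensorProduct.includeRight : Γ →ₐ[R] A ⊗[R] Γ).commutes r |>.symm

lemma inr_baseChangeRingHom_algebraMap (r : R) :
    inr A (A ⊗[R] Γ) (baseChangeRingHom (opBaseChangeEquiv R A Γ) (algebraMap R Γᵐᵒᵖ r)) =
      inl A (A ⊗[R] Γ) (algebraMap R (A ⊗[R] Γ) r) := by
  rw [algebraMap_baseChange, inl_algebraMap_eq_inr_algebraMap]
  exact congrArg (fun x => inr A (A ⊗[R] Γ) (op x)) (one_tmul_algebraMap A r)

lemma inl_baseChangeRingHom_algebraMap (r : R) :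
    inl A (A ⊗[R] Γ) (baseChangeRingHom (RingEquiv.refl (A ⊗[R] Γ)) (algebraMap R Γ r)) =
      inr A (A ⊗[R] Γ) (algebraMap R (A ⊗[R] Γ)ᵐᵒᵖ r) := by
  have h : algebraMap R (A ⊗[R] Γ)ᵐᵒᵖ r = algebraMap A (A ⊗[R] Γ)ᵐᵒᵖ (algebraMap R A r) :=
    congrArg op (algebraMap_baseChange A r)
  rw [h, ← inl_algebraMap_eq_inr_algebraMap]
  exact congrArg (inl A (A ⊗[R] Γ)) (one_tmul_algebraMap A r)

variable (R Γ) in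
/-- `b ↦ 1 ⊗ b` on opposite algebras. -/
def opIncludeRight : Γᵐᵒᵖ →ₗ[R] (A ⊗[R] Γ)ᵐᵒᵖ :=
  (opLinearEquiv R : A ⊗[R] Γ ≃ₗ[R] (A ⊗[R] Γ)ᵐᵒᵖ).toLinearMap ∘ₗ
    (Algebra.TensorProduct.includeRight : Γ →ₐ[R] A ⊗[R] Γ).toLinearMap ∘ₗ
      (opLinearEquiv R : Γ ≃ₗ[R] Γᵐᵒᵖ).symm.toLinearMap

variable (R Γ) in
lemma isLocalizedModule_includeRight (W : Submonoid R) [IsLocalization W A] : IsLocalizedModule W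
    (Algebra.TensorProduct.includeRight : Γ →ₐ[R] A ⊗[R] Γ).toLinearMap :=
  (isLocalizedModule_iff_isBaseChange W A _).2 (TensorProduct.isBaseChange R Γ _)

variable (R Γ) in
lemma isLocalizedModule_opIncludeRight (W : Submonoid R) [IsLocalization W A] :
    IsLocalizedModule W (opIncludeRight R Γ A) := by
  have := isLocalizedModule_includeRight R Γ A W
  have := IsLocalizedModule.of_linearEquiv_right W
    (Algebra.TensorProduct.includeRight : Γ →ₐ[R] A ⊗[R] Γ).toLinearMap
    (opLinearEquiv R : Γ ≃ₗ[R] Γᵐᵒᵖ).symm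
  exact IsLocalizedModule.of_linearEquiv W _ (opLinearEquiv R : A ⊗[R] Γ ≃ₗ[R] (A ⊗[R] Γ)ᵐᵒᵖ)

end OneTmul

/-- For derived endomorphisms of the right module, `Γᵐᵒᵖ` is the ring of the resolution and `Γ` the
ring that multiplies. -/
lemma MulIsIso.mulIsIsoAt_right {m : Ideal R} [m.IsPrime]
    {M : CochainComplex (ModuleCat.{u} (Env R Γ)) ℤ}
    (h : MulIsIso (inr (Localization.AtPrime m) (LocAlg m Γ))
      (inl (Localization.AtPrime m) (LocAlg m Γ)) (fun b a => (commute_inl_inr (Localization.AtPrime m) (LocAlg m Γ) a b).symm)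
      (locComplex m Γ M)) : MulIsIsoAt m (inr R Γ) (inl R Γ) M :=
  h.mulIsIsoAt (opBaseChangeEquiv R (Localization.AtPrime m) Γ)
    (fun i => locMap m (M.X i))
    (Algebra.TensorProduct.includeRight : Γ →ₐ[R] Localization.AtPrime m ⊗[R] Γ).toLinearMap
    (inr_baseChangeRingHom_algebraMap (Localization.AtPrime m))
    (fun i => (locCompatible_right m).isLocalizationMap (M.X i))
    (fun i j x => locMap_naturality (M.d i j) x) (isLocalizedModule_includeRight R Γ _ _)
    (fun i t x => ((locCompatible_left m).smul_toLoc (M.X i) t 1 x).symm)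

lemma MulIsIso.mulIsIsoAt_left {m : Ideal R} [m.IsPrime]
    {M : CochainComplex (ModuleCat.{u} (Env R Γ)) ℤ}
    (h : MulIsIso (inl (Localization.AtPrime m) (LocAlg m Γ))
      (inr (Localization.AtPrime m) (LocAlg m Γ)) (fun a b => commute_inl_inr (Localization.AtPrime m) (LocAlg m Γ) a b)
      (locComplex m Γ M)) : MulIsIsoAt m (inl R Γ) (inr R Γ) M :=
  h.mulIsIsoAt (RingEquiv.refl (LocAlg m Γ)) (fun i => locMap m (M.X i))
    (opIncludeRight R Γ (Localization.AtPrime m))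
    (inl_baseChangeRingHom_algebraMap (Localization.AtPrime m))
    (fun i => (locCompatible_left m).isLocalizationMap (M.X i))
    (fun i j x => locMap_naturality (M.d i j) x)
    (isLocalizedModule_opIncludeRight R Γ _ _)
    (fun i t x => ((locCompatible_right m).smul_toLoc (M.X i) t 1 x).symm)

lemma mulIsIso_inr_of_forall_maximal [IsNoetherianRing R] [Module.Finite R Γ]
    {M : CochainComplex (ModuleCat.{u} (Env R Γ)) ℤ} (hM : IsBiperfect R Γ M)
    (H : ∀ (m : Ideal R) [m.IsMaximal], MulIsIsoAt m (inr R Γ) (inl R Γ) M) :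
    MulIsIso (inr R Γ) (inl R Γ) (fun b a => (commute_inl_inr R Γ a b).symm) M :=
  mulIsIso_of_forall_maximal (inr R Γ) (inl R Γ) _
    (fun r => (inl_algebraMap_eq_inr_algebraMap r).symm) M hM.2 H

lemma mulIsIso_inl_of_forall_maximal [IsNoetherianRing R] [Module.Finite R Γ]
    {M : CochainComplex (ModuleCat.{u} (Env R Γ)) ℤ} (hM : IsBiperfect R Γ M)
    (H : ∀ (m : Ideal R) [m.IsMaximal], MulIsIsoAt m (inl R Γ) (inr R Γ) M) :
    MulIsIso (inl R Γ) (inr R Γ) (fun a b => commute_inl_inr R Γ a b) M :=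
  mulIsIso_of_forall_maximal (inl R Γ) (inr R Γ) _
    (fun r => inl_algebraMap_eq_inr_algebraMap r) M hM.1 H

theorem isTilting_of_forall_maximal [IsNoetherianRing R] [Module.Finite R Γ]
    (M : CochainComplex (ModuleCat.{u} (Env R Γ)) ℤ) (hM : IsBiperfect R Γ M)
    (H : ∀ (m : Ideal R) [m.IsMaximal],
      MulIsIsoAt m (inr R Γ) (inl R Γ) M ∧ MulIsIsoAt m (inl R Γ) (inr R Γ) M) :
    IsTilting R Γ M :=
  ⟨hM, mulIsIso_inr_of_forall_maximal hM fun m _ => (H m).1,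
    mulIsIso_inl_of_forall_maximal hM fun m _ => (H m).2⟩

lemma IsTilting.mulIsIsoAt {m : Ideal R} [m.IsPrime]
    {M : CochainComplex (ModuleCat.{u} (Env R Γ)) ℤ}
    (h : IsTilting (Localization.AtPrime m) (LocAlg m Γ) (locComplex m Γ M)) :
    MulIsIsoAt m (inr R Γ) (inl R Γ) M ∧ MulIsIsoAt m (inl R Γ) (inr R Γ) M :=
  ⟨h.left_mul.mulIsIsoAt_right, h.right_mul.mulIsIsoAt_left⟩

end Tilting

/-! ### Projectivity is local -/

section Projective

variable {R S : Type u} [CommRing R] [Ring S] [Algebra R S]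

lemma algebraMap_smul_toBaseChange {A S' : Type u} [CommRing A] [Algebra R A] [Ring S']
    (e : S' ≃+* A ⊗[R] S) (X : ModuleCat.{u} S) (r : R) (y : A ⊗[R] X) :
    baseChangeRingHom e (algebraMap R S r) • toBaseChange e X y = toBaseChange e X (r • y) := by
  induction y using TensorProduct.induction_on with
  | zero => rw [smul_zero, map_zero, smul_zero]
  | add y z hy hz => rw [map_add, smul_add, hy, hz, smul_add, map_add]
  | tmul a x =>
    rw [baseChangeRingHom_apply, symm_smul_toBaseChange, one_mul, algebraMap_smul, tmul_smul]

lemma isLocalizedModule_baseChangeUnit {A S' : Type u} [CommRing A] [Algebra R A] [Ring S']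
    (e : S' ≃+* A ⊗[R] S) (W : Submonoid R) [IsLocalization W A] (X : ModuleCat.{u} S) :
    IsLocalizedModule W ((baseChangeUnit e X).hom.restrictScalars R) := by
  have hloc : IsLocalizedModule W (TensorProduct.mk R A X 1) :=
    (isLocalizedModule_iff_isBaseChange W A _).2 (TensorProduct.isBaseChange R X A)
  let ε : A ⊗[R] X ≃ₗ[R]
      (ModuleCat.restrictScalars (baseChangeRingHom e)).obj (baseChangeObj e X) :=
    { (toBaseChange e X) with
      map_smul' := fun r y => (algebraMap_smul_toBaseChange e X r y).symm }
  exact IsLocalizedModule.of_linearEquiv W (TensorProduct.mk R A X 1) ε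

lemma exists_finite_projective_epi (X : ModuleCat.{u} S) [Module.Finite S X] :
    ∃ (F : ModuleCat.{u} S) (π : F ⟶ X), Module.Finite S F ∧ Projective F ∧ Epi π := by
  obtain ⟨k, π, hπ⟩ := Module.Finite.exists_fin' S X
  exact ⟨ModuleCat.of S (Fin k → S), ModuleCat.ofHom π,
    inferInstanceAs (Module.Finite S (Fin k → S)), inferInstance,
    (ModuleCat.epi_iff_surjective _).2 hπ⟩

variable (R) in
/-- Composition with a map of modules over an `R`-algebra is `R`-linear. -/
def compLeftLin {X F : ModuleCat.{u} S} (π : F ⟶ X) : (X →ₗ[S] F) →ₗ[R] (X →ₗ[S] X) where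
  toFun σ := π.hom ∘ₗ σ
  map_add' σ τ := LinearMap.comp_add σ τ π.hom
  map_smul' r σ := by
    ext x
    exact (π.hom.restrictScalars R).map_smul r (σ x)

/-- Projectivity of a finitely generated module over a module-finite algebra is local. -/
theorem projective_of_forall_maximal [IsNoetherianRing R] [Module.Finite R S]
    (X : ModuleCat.{u} S) [Module.Finite S X]
    (H : ∀ (m : Ideal R) [m.IsMaximal], ∃ (S' : Type u) (_ : Ring S')
      (e : S' ≃+* Localization.AtPrime m ⊗[R] S), Projective ((baseChangeFunctor e).obj X)) :
    Projective X := by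
  obtain ⟨F, π, _, _, _⟩ := exists_finite_projective_epi X
  -- A splitting of the cover `π` exists exactly when the identity lies in this `R`-submodule of the
  -- endomorphisms of `X`.
  have key : LinearMap.id ∈ LinearMap.range (compLeftLin R π) := by
    refine mem_of_forall_maximal _ _ fun m _ => ?_
    obtain ⟨S', _, e, hp⟩ := H m
    have : (baseChangeFunctor e).PreservesEpimorphisms :=
      Functor.preservesEpimorphisms_of_adjunction (baseChangeAdj e)
    let s := Projective.factorThru (𝟙 _) ((baseChangeFunctor e).map π)
    have hs : s ≫ (baseChangeFunctor e).map π = 𝟙 _ := Projective.factorThru_comp _ _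
    let ψ := baseChangeUnit e X ≫ (ModuleCat.restrictScalars (baseChangeRingHom e)).map s
    have := isLocalizedModule_baseChangeUnit e m.primeCompl F
    have := isLocalizedModule_baseChangeUnit e m.primeCompl X
    obtain ⟨σ, a, ha, hσ⟩ := exists_lift_of_isLocalizedModule m.primeCompl
      (baseChangeUnit e F).hom ψ.hom
    -- The lift `σ` of the local section satisfies `π σ = a` after localization, hence up to a
    -- further denominator.
    have hz : (baseChangeUnit e X).hom ∘ₗ (π.hom ∘ₗ σ - a • LinearMap.id) = 0 := by
      ext x
      have h₁ : (baseChangeUnit e X) (π (σ x)) =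
          (ModuleCat.restrictScalars (baseChangeRingHom e)).map ((baseChangeFunctor e).map π)
            (baseChangeUnit e F (σ x)) := (baseChangeMap_tmul e π 1 (σ x)).symm
      have h₂ : (baseChangeUnit e F) (σ x) = a • ψ x := LinearMap.congr_fun hσ x
      have h₃ : (ModuleCat.restrictScalars (baseChangeRingHom e)).map
          ((baseChangeFunctor e).map π) (ψ x) = baseChangeUnit e X x :=
        congrArg (fun φ : (baseChangeFunctor e).obj X ⟶ _ => φ (toBaseChange e X (1 ⊗ₜ x))) hs
      have h₄ : (baseChangeUnit e X) (a • x) = a • baseChangeUnit e X x :=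
        ((baseChangeUnit e X).hom.restrictScalars R).map_smul a x
      have h₅ := (((ModuleCat.restrictScalars (baseChangeRingHom e)).map
          ((baseChangeFunctor e).map π)).hom.restrictScalars R).map_smul a (ψ x)
      change baseChangeUnit e X (π (σ x) - a • x) = 0
      rw [map_sub, sub_eq_zero, h₁, h₂, h₄]
      exact h₅.trans (congrArg (a • ·) h₃)
    obtain ⟨b, hb, hbz⟩ := exists_smul_eq_zero_of_isLocalizedModule m.primeCompl
      (baseChangeUnit e X).hom _ hz
    refine ⟨b * a, mul_mem hb ha, b • σ, ?_⟩
    ext x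
    have := LinearMap.congr_fun hbz x
    change b • (π (σ x) - a • x) = 0 at this
    rw [smul_sub, sub_eq_zero] at this
    change π (b • σ x) = (b * a) • x
    rw [mul_smul, ← this]
    exact (π.hom.restrictScalars R).map_smul b (σ x)
  obtain ⟨s, hs⟩ := key
  exact (Retract.mk (ModuleCat.ofHom s) π (ModuleCat.hom_ext hs)).projective

end Projective

/-! ### Perfect complexes and cones -/

section Perfect

variable {S : Type u} [Ring S]

lemma IsPerfect.of_quasiIso {X Y : CochainComplex (ModuleCat.{u} S) ℤ} (hX : IsPerfect X)
    (q : X ⟶ Y) [QuasiIso q] : IsPerfect Y := by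
  obtain ⟨P, p, hP, hfp, hp⟩ := hX
  exact ⟨P, p ≫ q, hP, hfp, inferInstance⟩

lemma isZero_inDegreeZero_X (X : ModuleCat.{u} S) (i : ℤ) (hi : i < 0 ∨ 0 < i) :
    Limits.IsZero ((inDegreeZero X).X i) :=
  HomologicalComplex.isZero_single_obj_X _ _ _ _ (by omega)

lemma finite_projective_inDegreeZero_X (X : ModuleCat.{u} S) [Module.Finite S X] [Projective X]
    (i : ℤ) : Module.Finite S ((inDegreeZero X).X i) ∧
      Module.Projective S ((inDegreeZero X).X i) := by
  by_cases hi : i = 0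
  · subst hi
    let ε := (HomologicalComplex.singleObjXSelf (ComplexShape.up ℤ) (0 : ℤ) X).toLinearEquiv.symm
    have : Module.Projective S X := (IsProjective.iff_projective X).2 inferInstance
    exact ⟨Module.Finite.equiv ε, Module.Projective.of_equiv ε⟩
  · have := ModuleCat.subsingleton_of_isZero (isZero_inDegreeZero_X X i (by omega))
    exact ⟨inferInstance, inferInstance⟩

/-- In the derived category, a morphism of distinguished triangles with two invertible components
has the third invertible. -/
lemma quasiIso_mappingCone_map {C : Type*} [Category* C] [Abelian C]
    {K₁ L₁ K₂ L₂ : CochainComplex C ℤ} (φ₁ : K₁ ⟶ L₁) (φ₂ : K₂ ⟶ L₂) (a : K₁ ⟶ K₂) (b : L₁ ⟶ L₂)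
    (comm : φ₁ ≫ b = a ≫ φ₂) [QuasiIso a] [QuasiIso b] :
    QuasiIso (mappingCone.map φ₁ φ₂ a b comm) := by
  let := HasDerivedCategory.standard C
  rw [← DerivedCategory.isIso_Q_map_iff_quasiIso]
  exact Pretriangulated.isIso₃_of_isIso₁₂
    (DerivedCategory.Q.mapTriangle.map (mappingCone.triangleMap φ₁ φ₂ a b comm))
    (DerivedCategory.mappingCone_triangle_distinguished φ₁)
    (DerivedCategory.mappingCone_triangle_distinguished φ₂)
    (inferInstanceAs (IsIso (DerivedCategory.Q.map a)))
    (inferInstanceAs (IsIso (DerivedCategory.Q.map b)))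

/-- The cokernel of a map from a perfect complex to a bounded complex of projectives. -/
lemma IsPerfect.X₃_of_shortExact {T : ShortComplex (CochainComplex (ModuleCat.{u} S) ℤ)}
    (hT : T.ShortExact) (h₁ : IsPerfect T.X₁)
    (hb : ∃ a b : ℤ, ∀ i, i < a ∨ b < i → Limits.IsZero (T.X₂.X i))
    (hfp : ∀ i, Module.Finite S (T.X₂.X i) ∧ Module.Projective S (T.X₂.X i)) :
    IsPerfect T.X₃ := by
  obtain ⟨P, p, ⟨a, b, hP⟩, hfP, hp⟩ := h₁
  obtain ⟨a', b', hb⟩ := hb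
  have := mappingCone.quasiIso_descShortComplex hT
  have := quasiIso_mappingCone_map (p ≫ T.f) T.f p (𝟙 _) (by simp)
  -- The cone in degree `i` is the sum of `P.X (i + 1)` and `T.X₂.X i`, whence the bound `a - 1`. It
  -- maps to the cone of `T.f`, and that to `T.X₃`, by quasi-isomorphisms.
  refine ⟨mappingCone (p ≫ T.f), mappingCone.map (p ≫ T.f) T.f p (𝟙 _) (by simp) ≫
    mappingCone.descShortComplex T, ⟨min (a - 1) a', max b b', fun i hi => ?_⟩, fun i => ?_,
    inferInstance⟩
  · rw [mappingCone.isZero_X_iff]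
    exact ⟨hP _ (by omega), hb _ (by omega)⟩
  · let ε := ((HomologicalComplex.homotopyCofiber.XIsoBiprod (p ≫ T.f) i (i + 1) (by simp)) ≪≫
      ModuleCat.biprodIsoProd _ _).toLinearEquiv.symm
    have : Module.Finite S (P.X (i + 1)) := (hfP (i + 1)).1
    have : Module.Projective S (P.X (i + 1)) := (hfP (i + 1)).2
    have : Module.Finite S (T.X₂.X i) := (hfp i).1
    have : Module.Projective S (T.X₂.X i) := (hfp i).2
    exact ⟨Module.Finite.equiv ε, Module.Projective.of_equiv ε⟩

end Perfect

/-! ### Locally bounded projective dimension implies perfect -/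

section ProjectiveDimension

variable {R S : Type u} [CommRing R] [Ring S] [Algebra R S]

/-- A finitely generated module of locally bounded projective dimension is perfect. -/
theorem isPerfect_of_forall_maximal [IsNoetherianRing R] [Module.Finite R S] (n : ℕ)
    (X : ModuleCat.{u} S) [Module.Finite S X]
    (H : ∀ (m : Ideal R) [m.IsMaximal], ∃ (S' : Type u) (_ : Ring S')
      (e : S' ≃+* Localization.AtPrime m ⊗[R] S),
        HasProjectiveDimensionLE ((baseChangeFunctor e).obj X) n) :
    IsPerfect (inDegreeZero X) := by
  induction n generalizing X with
  | zero =>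
    simp only [← projective_iff_hasProjectiveDimensionLE_zero] at H
    have := projective_of_forall_maximal X H
    exact ⟨_, 𝟙 _, ⟨0, 0, isZero_inDegreeZero_X X⟩, finite_projective_inDegreeZero_X X,
      inferInstance⟩
  | succ n ih =>
    -- This makes the kernel of the cover finitely generated, so that the induction hypothesis
    -- applies.
    have : IsNoetherianRing S := IsNoetherianRing.of_finite R S
    obtain ⟨F, π, _, _, hπ⟩ := exists_finite_projective_epi X
    have hT := LinearMap.shortExact_shortComplexKer ((ModuleCat.epi_iff_surjective π).1 hπ)
    have hK := ih π.hom.shortComplexKer.X₁ fun m _ => by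
      obtain ⟨S', _, e, h⟩ := H m
      have : Module.Flat R (Localization.AtPrime m) :=
        IsLocalization.flat (Localization.AtPrime m) m.primeCompl
      have := (baseChangeFunctor e).preservesFiniteLimits_of_preservesHomology
      have := (baseChangeFunctor e).preservesFiniteColimits_of_preservesHomology
      -- Dimension at most `n` is encoded as less than `n + 1`: the bound `n + 2` on the quotient
      -- becomes `n + 1` on the kernel.
      exact ⟨S', _, e, ((hT.map_of_exact (baseChangeFunctor e)).hasProjectiveDimensionLT_X₃_iff
        n (projective_baseChange e F)).1 h⟩
    exact hK.X₃_of_shortExact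
      (hT.map_of_exact (HomologicalComplex.single (ModuleCat.{u} S) (ComplexShape.up ℤ) 0))
      ⟨0, 0, isZero_inDegreeZero_X F⟩ (finite_projective_inDegreeZero_X F)

end ProjectiveDimension

/-! ### Biperfectness of bimodules and the degree-zero case -/

section Bimodule

variable {R Γ : Type u} [CommRing R] [Ring Γ] [Algebra R Γ]

/-- Finiteness passes from `E` down to `R`, as `E` is finite over `R`, and from `R` up to `S`. -/
lemma finite_restrictScalars {S E : Type u} [Ring S] [Algebra R S] [Ring E] [Algebra R E]
    [Module.Finite R E] (f : S →+* E) (hf : ∀ r, f (algebraMap R S r) = algebraMap R E r)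
    (M : ModuleCat.{u} E) [Module.Finite E M] :
    Module.Finite S ((ModuleCat.restrictScalars f).obj M) := by
  have : Module.Finite R M := Module.Finite.trans E M
  let ε : M →ₗ[R] (ModuleCat.restrictScalars f).obj M :=
    { toFun := fun x => x
      map_add' := fun _ _ => rfl
      map_smul' := fun r x => by
        change algebraMap R E r • (show M from x) = f (algebraMap R S r) • (show M from x)
        rw [hf] }
  have : Module.Finite R ((ModuleCat.restrictScalars f).obj M) :=
    Module.Finite.of_surjective ε fun x => ⟨x, rfl⟩
  exact Module.Finite.of_restrictScalars_finite R S _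

lemma LocCompatible.hasProjectiveDimensionLE {m : Ideal R} [m.IsPrime] {S S' : Type u} [Ring S]
    [Algebra R S] [Ring S'] {e : S' ≃+* Localization.AtPrime m ⊗[R] S} {f : S →+* Env R Γ}
    {f' : S' →+* Env (Localization.AtPrime m) (LocAlg m Γ)} (hf : LocCompatible m e f f')
    (M : ModuleCat.{u} (Env R Γ)) (n : ℕ)
    (h : HasProjectiveDimensionLE ((ModuleCat.restrictScalars f').obj (locObj m Γ M)) n) :
    HasProjectiveDimensionLE
      ((baseChangeFunctor e).obj ((ModuleCat.restrictScalars f).obj M)) n := by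
  obtain ⟨ε⟩ := (hf.isLocalizationMap M).nonempty_iso
  exact hasProjectiveDimensionLT_of_iso ε.symm (n + 1)

lemma IsPerfect.mapHomologicalComplex_inDegreeZero {S E : Type u} [Ring S] [Ring E] (f : S →+* E)
    (M : ModuleCat.{u} E) (h : IsPerfect (inDegreeZero ((ModuleCat.restrictScalars f).obj M))) :
    IsPerfect (((ModuleCat.restrictScalars f).mapHomologicalComplex _).obj (inDegreeZero M)) :=
  h.of_quasiIso ((HomologicalComplex.singleMapHomologicalComplex (ModuleCat.restrictScalars f)
    (ComplexShape.up ℤ) 0).app M).inv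

theorem isBiperfect_of_forall_maximal [IsNoetherianRing R] [Module.Finite R Γ]
    (M : ModuleCat.{u} (Env R Γ)) [Module.Finite (Env R Γ) M] (n : ℕ)
    (hr : ∀ (m : Ideal R) [m.IsMaximal], HasProjectiveDimensionLE
      ((rightRes (Localization.AtPrime m) (LocAlg m Γ)).obj (locObj m Γ M)) n)
    (hl : ∀ (m : Ideal R) [m.IsMaximal], HasProjectiveDimensionLE
      ((leftRes (Localization.AtPrime m) (LocAlg m Γ)).obj (locObj m Γ M)) n) :
    IsBiperfect R Γ (inDegreeZero M) := by
  have : Module.Finite R Γᵐᵒᵖ := Module.Finite.equiv (opLinearEquiv R : Γ ≃ₗ[R] Γᵐᵒᵖ)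
  have : Module.Finite Γ ((leftRes R Γ).obj M) := finite_restrictScalars (R := R) (inl R Γ)
    (Algebra.TensorProduct.includeLeft : Γ →ₐ[R] Γ ⊗[R] Γᵐᵒᵖ).commutes M
  have : Module.Finite Γᵐᵒᵖ ((rightRes R Γ).obj M) := finite_restrictScalars (R := R) (inr R Γ)
    (Algebra.TensorProduct.includeRight : Γᵐᵒᵖ →ₐ[R] Γ ⊗[R] Γᵐᵒᵖ).commutes M
  refine ⟨IsPerfect.mapHomologicalComplex_inDegreeZero _ M
    (isPerfect_of_forall_maximal (R := R) n _ fun m _ => ?_),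
    IsPerfect.mapHomologicalComplex_inDegreeZero _ M
    (isPerfect_of_forall_maximal (R := R) n _ fun m _ => ?_)⟩
  · exact ⟨_, _, _, (locCompatible_left m).hasProjectiveDimensionLE M n (hl m)⟩
  · exact ⟨_, _, _, (locCompatible_right m).hasProjectiveDimensionLE M n (hr m)⟩

/-- The localization of a bimodule in degree zero. -/
def locComplexInDegreeZeroIso (m : Ideal R) [m.IsPrime] (M : ModuleCat.{u} (Env R Γ)) :
    inDegreeZero (locObj m Γ M) ≅ locComplex m Γ (inDegreeZero M) :=
  ((HomologicalComplex.singleMapHomologicalComplex (locFunctor m Γ)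
    (ComplexShape.up ℤ) 0).app M).symm

lemma IsTilting.mulIsIsoAt_inDegreeZero {m : Ideal R} [m.IsPrime] {M : ModuleCat.{u} (Env R Γ)}
    (h : IsTilting (Localization.AtPrime m) (LocAlg m Γ) (inDegreeZero (locObj m Γ M))) :
    MulIsIsoAt m (inr R Γ) (inl R Γ) (inDegreeZero M) ∧
      MulIsIsoAt m (inl R Γ) (inr R Γ) (inDegreeZero M) :=
  ⟨(h.left_mul.of_iso (locComplexInDegreeZeroIso m M)).mulIsIsoAt_right,
    (h.right_mul.of_iso (locComplexInDegreeZeroIso m M)).mulIsIsoAt_left⟩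

end Bimodule

end TiltingBimod

end

open TiltingBimod in
theorem mainTheorem7 (K : Type*) [Field K] (R : Type u) [CommRing R] [Algebra K R]
    [IsNoetherianRing R] (Γ : Type u) [Ring Γ] [Algebra R Γ] [Module.Finite R Γ] :
    (∀ M : CochainComplex (ModuleCat.{u} (Env R Γ)) ℤ,
      (∀ i, Module.Finite (Env R Γ) (M.X i)) →
      IsBiperfect R Γ M →
      (∀ (m : Ideal R) [m.IsMaximal],
        IsTilting (Localization.AtPrime m) (LocAlg m Γ) (locComplex m Γ M)) →
      IsTilting R Γ M) ∧
    (∀ M : ModuleCat.{u} (Env R Γ),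
      Module.Finite (Env R Γ) M →
      (∃ n : ℕ, ∀ (m : Ideal R) [m.IsMaximal],
        HasProjectiveDimensionLE
          ((rightRes (Localization.AtPrime m) (LocAlg m Γ)).obj (locObj m Γ M)) n ∧
        HasProjectiveDimensionLE
          ((leftRes (Localization.AtPrime m) (LocAlg m Γ)).obj (locObj m Γ M)) n ∧
        IsTilting (Localization.AtPrime m) (LocAlg m Γ) (inDegreeZero (locObj m Γ M))) →
      IsTilting R Γ (inDegreeZero M)) := by
  refine ⟨fun M _ hM H => isTilting_of_forall_maximal M hM fun m _ => (H m).mulIsIsoAt, ?_⟩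
  rintro M _ ⟨n, H⟩
  exact isTilting_of_forall_maximal _
    (isBiperfect_of_forall_maximal M n (fun m _ => (H m).1) fun m _ => (H m).2.1)
    fun m _ => (H m).2.2.mulIsIsoAt_inDegreeZero
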